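/- Let $\mathbb T$ be the unit circle with normalized Lebesgue measure, $H^2\subset L^2(\mathbb T)$ the Hardy space, $P_+$ the orthogonal projection of $L^2(\mathbb T)$ onto $H^2$ and $P_-=I-P_+$. For $H=\begin{pmatrix} f&\phi\\ g&\psi\end{pmatrix}$ with entries in $L^\infty(\mathbb T)$ let $$R_Hx=P_+fP_+x+P_-gP_+x+P_+\phi P_-x+P_-\psi P_-x,\qquad x\in L^2(\mathbb T).$$ Let $QC=(H^\infty+C(\mathbb T))\cap\overline{(H^\infty+C(\mathbb T))}$. For $A=C(\mathbb T)$ or $A=QC$ let $\mathfrak R_A$ be the $C^*$-algebra of operators on $L^2(\mathbb T)$ that is the norm closure of the set of finite sums of finite products of operators $R_H$, $H\in A_{2\times2}$, and let $\mathfrak{SR}_A$ (the semicommutator ideal) be the closed two-sided ideal of $\mathfrak R_A$ generated by all operators $$R_{\begin{pmatrix} f_1&\phi_1\\ g_1&\psi_1\end{pmatrix}}R_{\begin{pmatrix} f_2&\phi_2\\ g_2&\psi_2\end{pmatrix}}-R_{\begin{pmatrix} f_1f_2&\phi\\ g&\psi_1\psi_2\end{pmatrix}},\qquad f_i,g_i,\phi_i,\psi_i,g,\phi\in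 A.$$ Let $\mathcal K(L^2(\mathbb T))$ be the set of compact operators on $L^2(\mathbb T)$, and for $|w|<1$ let $k_w(z)=\sqrt{1-|w|^2}/(1-\bar wz)$ be the normalized reproducing kernel of $H^2$. Then: 1. $\mathfrak{SR}_{C(\mathbb T)}=\mathcal K(L^2(\mathbb T))$ and $\mathfrak{SR}_{QC}=\mathcal K(L^2(\mathbb T))$. 2. $\mathcal K(L^2(\mathbb T))\subset\mathfrak R_{C(\mathbb T)}$, and there is a $*$-homomorphism $\rho:\mathfrak R_{C(\mathbb T)}\to C(\mathbb T)\oplus C(\mathbb T)$, given for $T\in\mathfrak R_{C(\mathbb T)}$ and $\xi\in\mathbb T$ by $$\rho(T)(\xi)=\Big(\lim_{r\to1^-}\langle Tk_{r\xi},k_{r\xi}\rangle,\ \lim_{r\to1^-}\langle T\bar z\bar k_{r\xi},\bar z\bar k_{r\xi}\rangle\Big)$$ (both limits exist), with $\rho(R_H)=(f,\psi)$ for $H=\begin{pmatrix} f&\phi\\ g&\psi\end{pmatrix}\in C(\mathbb T)_{2\times2}$, such that the sequence $$0\longrightarrow\mathcal K(L^2(\mathbb T))\longrightarrow\mathfrak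 R_{C(\mathbb T)}\overset{\rho}{\longrightarrow}C(\mathbb T)\oplus C(\mathbb T)\longrightarrow0$$ is exact, where the first map is the inclusion. The map $\rho$ induces an isometric $*$-isomorphism of $\mathfrak R_{C(\mathbb T)}/\mathcal K(L^2(\mathbb T))$, with the quotient norm, onto $C(\mathbb T)\oplus C(\mathbb T)$ with the norm $\|(a,b)\|=\max\{\|a\|_\infty,\|b\|_\infty\}$. -/

import Mathlib

open MeasureTheory Filter Topology AddCircle
open scoped ENNReal Real ComplexConjugate InnerProductSpace

noncomputable section

namespace GSIO

instance factTwoPiPos : Fact (0 < 2 * π) := ⟨Real.two_pi_pos⟩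

/-- The unit circle `𝕋`, parametrized by the angle `θ ∈ ℝ / 2πℤ`; the coordinate function
`z = e^{iθ}` is `fourier 1`. -/
abbrev Torus : Type := AddCircle (2 * π)

/-- Normalized Lebesgue measure `dθ / 2π` on the circle. -/
abbrev circleMeasure : Measure Torus := haarAddCircle

/-- `L²(𝕋)`. -/
abbrev L2 : Type := Lp ℂ 2 circleMeasure

/-- `L^∞(𝕋)`. -/
abbrev LInf : Type := Lp ℂ ∞ circleMeasure

/-- The inclusion `C(𝕋) → L^∞(𝕋)`. -/
abbrev contToLInf (f : C(Torus, ℂ)) : LInf := ContinuousMap.toLp (E := ℂ) ∞ circleMeasure ℂ f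

/-- The inclusion `C(𝕋) → L²(𝕋)`. -/
abbrev contToL2 (f : C(Torus, ℂ)) : L2 := ContinuousMap.toLp (E := ℂ) 2 circleMeasure ℂ f

/-! ### Hardy space and Riesz projections -/

/-- `H²`: the functions in `L²(𝕋)` whose Fourier coefficients of negative index vanish. -/
def hardyTwo : Submodule ℂ L2 where
  carrier := {x | ∀ n : ℤ, n < 0 → fourierCoeff (x : Torus → ℂ) n = 0}
  add_mem' := by
    intro x y hx hy n hn
    have h := hx n hn
    have h' := hy n hn
    rw [← fourierBasis_repr] at h h' ⊢
    simp [map_add, h, h']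
  zero_mem' := by
    intro n _
    rw [← fourierBasis_repr]
    simp
  smul_mem' := by
    intro c x hx n hn
    have h := hx n hn
    rw [← fourierBasis_repr] at h ⊢
    simp [map_smul, h]

theorem isClosed_hardyTwo : IsClosed (hardyTwo : Set L2) := by
  have : (hardyTwo : Set L2) =
      ⋂ n : ℤ, ⋂ _ : n < 0, {x : L2 | ⟪fourierBasis (T := 2 * π) n, x⟫_ℂ = 0} := by
    ext x
    simp only [Set.mem_iInter, Set.mem_ofPred_eq, ← HilbertBasis.repr_apply_apply,
      fourierBasis_repr]
    rfl
  rw [this]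
  refine isClosed_iInter fun n => isClosed_iInter fun _ => ?_
  exact isClosed_eq (continuous_const.inner continuous_id) continuous_const

instance completeSpace_hardyTwo : CompleteSpace hardyTwo :=
  isClosed_hardyTwo.completeSpace_coe

/-- The Riesz projection `P₊` of `L²(𝕋)` onto `H²`. -/
def Pplus : L2 →L[ℂ] L2 := hardyTwo.starProjection

/-- The complementary projection `P₋ = I - P₊`. -/
def Pminus : L2 →L[ℂ] L2 := 1 - Pplus

/-! ### Generalized singular integral operators -/

/-- The multiplication operator `M_f x = f x` on `L²(𝕋)`, for `f ∈ L^∞(𝕋)`. -/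
def mulOp (f : LInf) : L2 →L[ℂ] L2 :=
  (ContinuousLinearMap.mul ℂ ℂ).holderL circleMeasure ∞ 2 2 f

/-- The generalized singular integral operator `R_H` with bounded symbol
`H = (f, φ; g, ψ)`, that is `P₊ f P₊ + P₋ g P₊ + P₊ φ P₋ + P₋ ψ P₋`. -/
def gsio (H : Matrix (Fin 2) (Fin 2) LInf) : L2 →L[ℂ] L2 :=
  Pplus * mulOp (H 0 0) * Pplus + Pminus * mulOp (H 1 0) * Pplus +
    Pplus * mulOp (H 0 1) * Pminus + Pminus * mulOp (H 1 1) * Pminus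

/-- The operators `R_H` with `H` a `2 × 2` matrix with entries in `A`. -/
def gsioSet (A : Set LInf) : Set (L2 →L[ℂ] L2) :=
  {T | ∃ H : Matrix (Fin 2) (Fin 2) LInf, (∀ i j, H i j ∈ A) ∧ T = gsio H}

/-- `R_A`: the C⋆-algebra of operators on `L²(𝕋)` generated by the `R_H`, `H ∈ A_{2×2}`.
When `A` contains the constants and is closed under conjugation it is the norm closure
of the finite sums of finite products of such operators, see `coe_gsioAlgebra`. -/
def gsioAlgebra (A : Set LInf) : StarSubalgebra ℂ (L2 →L[ℂ] L2) :=
  (StarAlgebra.adjoin ℂ (gsioSet A)).topologicalClosure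

theorem mulOp_star (f : LInf) : star (mulOp f) = mulOp (star f) := by
  rw [ContinuousLinearMap.star_eq_adjoint, eq_comm, ContinuousLinearMap.eq_adjoint_iff]
  intro x y
  rw [L2.inner_def, L2.inner_def]
  refine integral_congr_ae ?_
  have h1 := (ContinuousLinearMap.mul ℂ ℂ).coeFn_holder (r := 2) (star f) x
  have h2 := (ContinuousLinearMap.mul ℂ ℂ).coeFn_holder (r := 2) f y
  filter_upwards [h1, h2, Lp.coeFn_star f] with t h1 h2 h3
  simp only [mulOp, ContinuousLinearMap.holderL_apply_apply, h1, h2, h3]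
  simp
  ring

theorem Pplus_star : star Pplus = Pplus :=
  isSelfAdjoint_starProjection hardyTwo

theorem Pminus_star : star Pminus = Pminus := by
  simp [Pminus, Pplus_star]

theorem gsio_star (H : Matrix (Fin 2) (Fin 2) LInf) :
    star (gsio H) = gsio (fun i j => star (H j i)) := by
  simp only [gsio, star_add, star_mul, mulOp_star, Pplus_star, Pminus_star, mul_assoc]
  abel

theorem mulOp_const (c : ℂ) :
    mulOp (contToLInf (ContinuousMap.const _ c)) = algebraMap ℂ (L2 →L[ℂ] L2) c := by
  ext x
  have h1 := (ContinuousLinearMap.mul ℂ ℂ).coeFn_holder (r := 2)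
    (contToLInf (ContinuousMap.const _ c)) x
  have h2 := ContinuousMap.coeFn_toLp (E := ℂ) (p := ∞) (𝕜 := ℂ) circleMeasure
    (ContinuousMap.const Torus c)
  have h3 := Lp.coeFn_smul c x
  rw [Algebra.algebraMap_eq_smul_one]
  filter_upwards [h1, h2, h3] with t h1 h2 h3
  simp only [mulOp, ContinuousLinearMap.holderL_apply_apply, h1, h2]
  simp_all

theorem Pplus_mul_Pplus : Pplus * Pplus = Pplus :=
  (hardyTwo.isIdempotentElem_starProjection)

theorem gsio_const (c : ℂ) :
    gsio !![contToLInf (ContinuousMap.const _ c), 0; 0, contToLInf (ContinuousMap.const _ c)] =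
      algebraMap ℂ (L2 →L[ℂ] L2) c := by
  have h0 : mulOp 0 = 0 := by simp [mulOp]
  have hm : Pminus * Pminus = Pminus := by
    simp [Pminus, mul_sub, sub_mul, Pplus_mul_Pplus]
  simp only [gsio, Matrix.of_apply, Matrix.cons_val', Matrix.cons_val_zero, Matrix.cons_val_one,
    Matrix.cons_val_fin_one, h0, mulOp_const, mul_zero, zero_mul, add_zero]
  rw [← Algebra.commutes, ← Algebra.commutes, mul_assoc, mul_assoc, Pplus_mul_Pplus, hm,
    ← mul_add]
  simp [Pminus]

/-- `R_A` is the norm closure of the set of finite sums of finite products of operators `R_H`,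
`H ∈ A_{2×2}`. -/
theorem coe_gsioAlgebra (A : Set LInf)
    (hconst : ∀ c : ℂ, contToLInf (ContinuousMap.const _ c) ∈ A)
    (hstar : ∀ f ∈ A, star f ∈ A) :
    (gsioAlgebra A : Set (L2 →L[ℂ] L2)) =
      closure (AddSubmonoid.closure (Submonoid.closure (gsioSet A) : Set (L2 →L[ℂ] L2)) :
        Set (L2 →L[ℂ] L2)) := by
  rw [gsioAlgebra, StarSubalgebra.topologicalClosure_coe]
  congr 1
  rw [← Subsemiring.coe_closure_eq]
  have hz : (0 : LInf) ∈ A := by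
    simpa [contToLInf] using hconst 0
  apply Set.Subset.antisymm
  · intro T hT
    induction hT using StarAlgebra.adjoin_induction with
    | mem x hx => exact Subsemiring.subset_closure hx
    | algebraMap c =>
      refine Subsemiring.subset_closure ⟨_, ?_, (gsio_const c).symm⟩
      intro i j
      fin_cases i <;> fin_cases j <;> simp [hz, hconst]
    | add x y _ _ hx hy => exact add_mem hx hy
    | mul x y _ _ hx hy => exact mul_mem hx hy
    | star x hx' hx =>
      clear hx'
      induction hx using Subsemiring.closure_induction with
      | mem x hx =>
        obtain ⟨H, hH, rfl⟩ := hx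
        exact Subsemiring.subset_closure ⟨_, fun i j => hstar _ (hH j i), gsio_star H⟩
      | zero => simp
      | one => simp
      | add x y _ _ hx hy => rw [star_add]; exact add_mem hx hy
      | mul x y _ _ hx hy => rw [star_mul]; exact mul_mem hy hx
  · intro T hT
    have : Subsemiring.closure (gsioSet A) ≤
        (StarAlgebra.adjoin ℂ (gsioSet A)).toSubalgebra.toSubsemiring :=
      Subsemiring.closure_le.2 (StarAlgebra.subset_adjoin ℂ _)
    exact this hT

/-! ### The semicommutator ideal -/

/-- The operators `R_{(f₁, φ₁; g₁, ψ₁)} R_{(f₂, φ₂; g₂, ψ₂)} - R_{(f₁ f₂, φ; g, ψ₁ ψ₂)}` with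
`fᵢ, gᵢ, φᵢ, ψᵢ, g, φ ∈ A`. Here `•` is the pointwise product of `L^∞(𝕋)`. -/
def semicommutators (A : Set LInf) : Set (L2 →L[ℂ] L2) :=
  {T | ∃ f₁ ∈ A, ∃ g₁ ∈ A, ∃ φ₁ ∈ A, ∃ ψ₁ ∈ A, ∃ f₂ ∈ A, ∃ g₂ ∈ A, ∃ φ₂ ∈ A, ∃ ψ₂ ∈ A,
    ∃ g ∈ A, ∃ φ ∈ A,
      T = gsio !![f₁, φ₁; g₁, ψ₁] * gsio !![f₂, φ₂; g₂, ψ₂] -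
        gsio !![(f₁ • f₂ : LInf), φ; g, (ψ₁ • ψ₂ : LInf)]}

/-- `J` is a norm closed two-sided ideal of the operator algebra `R`. -/
structure IsClosedIdeal (R : StarSubalgebra ℂ (L2 →L[ℂ] L2))
    (J : Submodule ℂ (L2 →L[ℂ] L2)) : Prop where
  subset : ∀ T ∈ J, T ∈ R
  isClosed : IsClosed (J : Set (L2 →L[ℂ] L2))
  mul_left : ∀ S ∈ R, ∀ T ∈ J, S * T ∈ J
  mul_right : ∀ S ∈ R, ∀ T ∈ J, T * S ∈ J

/-- The closed two-sided ideal of `R_A` generated by the semicommutators. -/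
def semicommutatorIdeal (A : Set LInf) : Submodule ℂ (L2 →L[ℂ] L2) :=
  sInf {J | IsClosedIdeal (gsioAlgebra A) J ∧ semicommutators A ⊆ J}

/-! ### Continuous and quasicontinuous symbols -/

/-- `C(𝕋)` as a subset of `L^∞(𝕋)`. -/
def continuousSymbols : Set LInf := Set.range contToLInf

/-- `H^∞`: the functions in `L^∞(𝕋)` whose Fourier coefficients of negative index vanish. -/
def hardyInf : Set LInf := {f | ∀ n : ℤ, n < 0 → fourierCoeff (f : Torus → ℂ) n = 0}

/-- `H^∞ + C(𝕋)`. -/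
def hardyInfPlusC : Set LInf := {f | ∃ h ∈ hardyInf, ∃ c : C(Torus, ℂ), f = h + contToLInf c}

/-- `QC`, the intersection of `H^∞ + C(𝕋)` with the set of its complex conjugates. -/
def quasicontinuous : Set LInf := {f | f ∈ hardyInfPlusC ∧ star f ∈ hardyInfPlusC}

theorem star_contToLInf (f : C(Torus, ℂ)) : star (contToLInf f) = contToLInf (star f) := by
  ext1
  have h1 := ContinuousMap.coeFn_toLp (E := ℂ) (p := ∞) (𝕜 := ℂ) circleMeasure f
  have h2 := ContinuousMap.coeFn_toLp (E := ℂ) (p := ∞) (𝕜 := ℂ) circleMeasure (star f)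
  filter_upwards [h1, h2, Lp.coeFn_star (contToLInf f)] with t h1 h2 h3
  rw [h3, h2, Pi.star_apply, h1]
  rfl

theorem contToLInf_mem_hardyInfPlusC (f : C(Torus, ℂ)) : contToLInf f ∈ hardyInfPlusC := by
  refine ⟨0, fun n _ => ?_, f, (zero_add _).symm⟩
  have h : (fun t => fourier (-n) t • ((0 : LInf) : Torus → ℂ) t) =ᵐ[circleMeasure] 0 := by
    filter_upwards [Lp.coeFn_zero ℂ ∞ circleMeasure] with t _
    simp
  rw [fourierCoeff, integral_congr_ae h]
  simp

/-- `R_{C(𝕋)}` as a closure of finite sums of finite products. -/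
theorem coe_gsioAlgebra_continuousSymbols :
    (gsioAlgebra continuousSymbols : Set (L2 →L[ℂ] L2)) =
      closure (AddSubmonoid.closure (Submonoid.closure (gsioSet continuousSymbols) :
        Set (L2 →L[ℂ] L2)) : Set (L2 →L[ℂ] L2)) :=
  coe_gsioAlgebra _ (fun _ => ⟨_, rfl⟩)
    (by rintro _ ⟨f, rfl⟩; exact ⟨star f, (star_contToLInf f).symm⟩)

/-- `R_{QC}` as a closure of finite sums of finite products. -/
theorem coe_gsioAlgebra_quasicontinuous :
    (gsioAlgebra quasicontinuous : Set (L2 →L[ℂ] L2)) =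
      closure (AddSubmonoid.closure (Submonoid.closure (gsioSet quasicontinuous) :
        Set (L2 →L[ℂ] L2)) : Set (L2 →L[ℂ] L2)) :=
  coe_gsioAlgebra _
    (fun _ => ⟨contToLInf_mem_hardyInfPlusC _,
      by rw [star_contToLInf]; exact contToLInf_mem_hardyInfPlusC _⟩)
    (fun f hf => ⟨hf.2, by rw [star_star]; exact hf.1⟩)

/-! ### Compact operators and the quotient by them -/

/-- `𝒦(L²(𝕋))`. -/
abbrev compacts : Submodule ℂ (L2 →L[ℂ] L2) := compactOperator (RingHom.id ℂ) L2 L2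

theorem isCompactOperator_star {T : L2 →L[ℂ] L2} (hT : IsCompactOperator T) :
    IsCompactOperator (star T : L2 →L[ℂ] L2) := by
  have hS : IsCompactOperator (T * star T : L2 →L[ℂ] L2) := hT.comp_clm (star T)
  refine (isCompactOperator_iff_isCompact_closure_image_closedBall
    (star T : L2 →L[ℂ] L2).toLinearMap one_pos).2 ?_
  have hS' := ((isCompactOperator_iff_isCompact_closure_image_closedBall
    (T * star T : L2 →L[ℂ] L2).toLinearMap one_pos).1 hS).totallyBounded.subset subset_closure
  refine TotallyBounded.isCompact_of_isClosed (TotallyBounded.closure ?_) isClosed_closure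
  rw [Metric.totallyBounded_iff]
  intro ε hε
  obtain ⟨t, hts, htf, ht⟩ := Metric.finite_approx_of_totallyBounded hS' (ε ^ 2 / 4) (by positivity)
  have hx : ∀ y ∈ t, ∃ x ∈ Metric.closedBall (0 : L2) 1, (T * star T) x = y := fun y hy => hts hy
  choose! g hg1 hg2 using hx
  refine ⟨(fun y => star T (g y)) '' t, htf.image _, ?_⟩
  rintro _ ⟨x, hx, rfl⟩
  obtain ⟨y, hy, hxy⟩ := Set.mem_iUnion₂.1 (ht ⟨x, hx, rfl⟩)
  refine Set.mem_iUnion₂.2 ⟨_, ⟨y, hy, rfl⟩, ?_⟩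
  rw [mem_ball_iff_norm] at hxy ⊢
  rw [← hg2 y hy] at hxy
  change ‖(T * star T) x - (T * star T) (g y)‖ < _ at hxy
  change ‖star T x - star T (g y)‖ < ε
  rw [← map_sub] at hxy ⊢
  have h1 : ‖x - g y‖ ≤ 2 := by
    have a := mem_closedBall_zero_iff.1 hx
    have b := mem_closedBall_zero_iff.1 (hg1 y hy)
    linarith [norm_sub_le x (g y)]
  have h2 : ‖star T (x - g y)‖ ^ 2 ≤ ‖(T * star T) (x - g y)‖ * ‖x - g y‖ := by
    have : ⟪(T * star T) (x - g y), x - g y⟫_ℂ = ⟪star T (x - g y), star T (x - g y)⟫_ℂ := by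
      rw [ContinuousLinearMap.star_eq_adjoint, ContinuousLinearMap.adjoint_inner_right]
      rfl
    rw [← inner_self_eq_norm_sq (𝕜 := ℂ), ← this]
    exact (RCLike.re_le_norm _).trans (norm_inner_le_norm _ _)
  nlinarith [norm_nonneg ((T * star T) (x - g y)), norm_nonneg (star T (x - g y)),
    norm_nonneg (x - g y)]

/-- The ideal of the compact operators that belong to `R`. -/
def compactIdeal (R : StarSubalgebra ℂ (L2 →L[ℂ] L2)) : Ideal R where
  carrier := {T | IsCompactOperator (T : L2 →L[ℂ] L2)}
  add_mem' hS hT := IsCompactOperator.add hS hT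
  zero_mem' := isCompactOperator_zero
  smul_mem' S _ hT := IsCompactOperator.clm_comp hT (S : L2 →L[ℂ] L2)

instance isTwoSided_compactIdeal (R : StarSubalgebra ℂ (L2 →L[ℂ] L2)) :
    (compactIdeal R).IsTwoSided where
  mul_mem_of_left {_} S hT := IsCompactOperator.comp_clm hT (S : L2 →L[ℂ] L2)

/-- The involution `(T + 𝒦)⋆ = T⋆ + 𝒦` on the quotient of `R` by its compact operators. -/
instance starRingQuotient (R : StarSubalgebra ℂ (L2 →L[ℂ] L2)) :
    StarRing (R ⧸ compactIdeal R) where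
  star := Quotient.map' star (by
    intro S T h
    rw [Submodule.quotientRel_def] at h ⊢
    rw [← star_sub]
    exact isCompactOperator_star h)
  star_involutive := by
    rintro ⟨T⟩
    exact congrArg (Ideal.Quotient.mk (compactIdeal R)) (star_star T)
  star_mul := by
    rintro ⟨S⟩ ⟨T⟩
    exact congrArg (Ideal.Quotient.mk (compactIdeal R)) (star_mul S T)
  star_add := by
    rintro ⟨S⟩ ⟨T⟩
    exact congrArg (Ideal.Quotient.mk (compactIdeal R)) (star_add S T)

/-! ### The symbol map -/

/-- The normalized reproducing kernel `k_w = √(1 - |w|²) / (1 - w̄ z)` of `H²` at a point `w` of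
the open unit disc, as a continuous function on the circle. -/
def kernelFun (w : ℂ) (hw : ‖w‖ < 1) : C(Torus, ℂ) where
  toFun t := (√(1 - ‖w‖ ^ 2) : ℂ) / (1 - conj w * fourier 1 t)
  continuous_toFun := by
    refine continuous_const.div
      (continuous_const.sub (continuous_const.mul (fourier 1).continuous)) fun t h => ?_
    have h1 : ‖conj w * fourier 1 t‖ = 1 := by rw [← sub_eq_zero.1 h]; simp
    rw [norm_mul, RCLike.norm_conj, fourier_apply, Circle.norm_coe, mul_one] at h1
    exact hw.ne h1

open Classical in
/-- `k_w` as an element of `L²(𝕋)` (and `0` outside of the open unit disc). -/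
def kernelPlus (w : ℂ) : L2 := if hw : ‖w‖ < 1 then contToL2 (kernelFun w hw) else 0

open Classical in
/-- `z̄ k̄_w` as an element of `L²(𝕋)` (and `0` outside of the open unit disc). -/
def kernelMinus (w : ℂ) : L2 :=
  if hw : ‖w‖ < 1 then contToL2 (star (fourier 1 * kernelFun w hw)) else 0

end GSIO

end

open GSIO

noncomputable section

namespace GSIO

/-! Split `L²` into `H²` and its orthogonal complement. The off-diagonal blocks of `R_H` are the
Hankel operators `P₋ g P₊` and `P₊ φ P₋`. The operator `P₋ f P₊` vanishes for `f ∈ H^∞` and has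
finite rank for `f = zᵏ`, so by density it is compact for `f ∈ H^∞ + C`; taking adjoints gives the
other block. For symbols in `QC`, `R_H` is therefore block diagonal modulo compact operators, and a
semicommutator of block diagonal operators is a sum of products with a Hankel factor
(`diagOp_mul_sub_mem_compacts`). So the semicommutators are compact.

Conversely, the semicommutator of `z` and `z̄` is minus the projection onto the constants.
Multiplying it by powers of `z` on both sides gives all matrix units, whose closed span is `𝒦`
(`compacts_le_of_rankOne_zero_mem`). This proves the first part, and `𝒦 ⊆ R_A`.

For the second part, `symbolOp` is a linear `⋆`-map that is multiplicative modulo `𝒦`, so the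
operators `symbolOp a + K` with `K` compact form a `⋆`-algebra containing the generators. The
decisive estimate is `‖a‖ ≤ ‖symbolOp a + K‖` (`HasSymbol.norm_le`). As `w = rξ` tends to `ξ`, the
functions `|k_w|²` are Poisson kernels concentrating at `ξ`, while `k_w` and `z̄ k̄_w` tend weakly
to zero, so the two vector states recover `a.1 ξ` and `a.2 ξ` and annihilate `K`. Hence the symbol
is unique, the algebra is closed, and `R_C` lies in it. Together with `norm_symbolOp_le` the
estimate makes the quotient map isometric. -/

/-- The exponential monomial `zⁿ` as an element of `L²(𝕋)`. -/
abbrev monomial (n : ℤ) : L2 := fourierLp (T := 2 * π) 2 n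

/-! ### Multiplication operators with bounded and with continuous symbols -/

theorem coeFn_mulOp (f : LInf) (x : L2) :
    (mulOp f x : Torus → ℂ) =ᵐ[circleMeasure] fun t => f t * x t := by
  simpa [mulOp] using (ContinuousLinearMap.mul ℂ ℂ).coeFn_holder (r := 2) f x

theorem mulOp_smul_eq_mul (f g : LInf) : mulOp (f • g : LInf) = mulOp f * mulOp g := by
  ext1 x
  ext1
  filter_upwards [coeFn_mulOp (f • g : LInf) x, coeFn_mulOp f (mulOp g x), coeFn_mulOp g x,
    Lp.coeFn_lpSMul (r := ∞) f g] with t h1 h2 h3 h4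
  rw [h1, mul_apply_eq_comp, h2, h3, h4]
  simp [mul_assoc]

theorem mulOp_add (f g : LInf) : mulOp (f + g) = mulOp f + mulOp g := by
  simp [mulOp]

theorem mulOp_zero : mulOp 0 = 0 := by simp [mulOp]

theorem norm_mulOp_le (f : LInf) : ‖mulOp f‖ ≤ ‖f‖ := by
  refine ContinuousLinearMap.opNorm_le_bound _ (norm_nonneg _) fun x => ?_
  have := (ContinuousLinearMap.mul ℂ ℂ).norm_holder_apply_apply_le (r := 2) f x
  refine this.trans ?_
  simp

theorem norm_contToLInf_le (f : C(Torus, ℂ)) : ‖contToLInf f‖ ≤ ‖f‖ := by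
  have h := ContinuousMap.toLp_norm_le (E := ℂ) (p := ∞) (𝕜 := ℂ) circleMeasure
  refine (ContinuousLinearMap.le_opNorm _ f).trans ?_
  refine mul_le_of_le_one_left (norm_nonneg _) (h.trans ?_)
  simp

/-- Multiplication by a continuous function, as a continuous linear function of the symbol. -/
def contMulOp : C(Torus, ℂ) →L[ℂ] L2 →L[ℂ] L2 :=
  ((ContinuousLinearMap.mul ℂ ℂ).holderL circleMeasure ∞ 2 2).comp
    (ContinuousMap.toLp (E := ℂ) ∞ circleMeasure ℂ)

theorem mulOp_contToLInf (f : C(Torus, ℂ)) : mulOp (contToLInf f) = contMulOp f := rfl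

theorem contMulOp_contToL2 (f g : C(Torus, ℂ)) :
    contMulOp f (contToL2 g) = contToL2 (f * g) := by
  ext1
  have h1 := ContinuousMap.coeFn_toLp (E := ℂ) (p := ∞) (𝕜 := ℂ) circleMeasure f
  have h2 := ContinuousMap.coeFn_toLp (E := ℂ) (p := 2) (𝕜 := ℂ) circleMeasure g
  have h3 := ContinuousMap.coeFn_toLp (E := ℂ) (p := 2) (𝕜 := ℂ) circleMeasure (f * g)
  filter_upwards [coeFn_mulOp (contToLInf f) (contToL2 g), h1, h2, h3] with t h h1 h2 h3
  rw [← mulOp_contToLInf, h, h1, h2, h3]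
  rfl

theorem contToLInf_smul (f g : C(Torus, ℂ)) :
    (contToLInf f • contToLInf g : LInf) = contToLInf (f * g) := by
  ext1
  have h1 := ContinuousMap.coeFn_toLp (E := ℂ) (p := ∞) (𝕜 := ℂ) circleMeasure f
  have h2 := ContinuousMap.coeFn_toLp (E := ℂ) (p := ∞) (𝕜 := ℂ) circleMeasure g
  have h3 := ContinuousMap.coeFn_toLp (E := ℂ) (p := ∞) (𝕜 := ℂ) circleMeasure (f * g)
  filter_upwards [Lp.coeFn_lpSMul (r := ∞) (contToLInf f) (contToLInf g), h1, h2, h3]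
    with t h h1 h2 h3
  rw [h, Pi.smul_apply', h1, h2, h3]
  rfl

theorem contMulOp_mul (f g : C(Torus, ℂ)) : contMulOp (f * g) = contMulOp f * contMulOp g := by
  rw [← mulOp_contToLInf, ← contToLInf_smul, mulOp_smul_eq_mul]
  rfl

theorem contMulOp_one : contMulOp 1 = 1 := by
  rw [← mulOp_contToLInf]
  simpa using mulOp_const 1

theorem contMulOp_star (f : C(Torus, ℂ)) : contMulOp (star f) = star (contMulOp f) := by
  rw [← mulOp_contToLInf, ← mulOp_contToLInf, mulOp_star, star_contToLInf]

theorem norm_contMulOp_le (f : C(Torus, ℂ)) : ‖contMulOp f‖ ≤ ‖f‖ :=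
  (norm_mulOp_le _).trans (norm_contToLInf_le f)

theorem contMulOp_fourier_monomial (m n : ℤ) :
    contMulOp (fourier m) (monomial n) = monomial (m + n) := by
  rw [monomial, fourierLp, contMulOp_contToL2, monomial, fourierLp]
  congr 1
  ext t
  simp

/-! ### Fourier monomials and the Riesz projections -/

theorem orthonormal_monomial : Orthonormal ℂ monomial := orthonormal_fourier

theorem inner_monomial (m n : ℤ) : ⟪monomial m, monomial n⟫_ℂ = if m = n then 1 else 0 :=
  orthonormal_iff_ite.1 orthonormal_monomial m n

theorem inner_monomial_left (n : ℤ) (x : L2) :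
    ⟪monomial n, x⟫_ℂ = fourierCoeff (x : Torus → ℂ) n := by
  rw [← fourierBasis_repr, HilbertBasis.repr_apply_apply, coe_fourierBasis]

theorem topologicalClosure_span_monomial :
    (Submodule.span ℂ (Set.range monomial)).topologicalClosure = ⊤ := by
  have := (fourierBasis (T := 2 * π)).dense_span
  rwa [coe_fourierBasis] at this

theorem dense_span_monomial : Dense (Submodule.span ℂ (Set.range monomial) : Set L2) :=
  Submodule.dense_iff_topologicalClosure_eq_top.2 topologicalClosure_span_monomial

/-- Operators that agree on all monomials are equal. -/
theorem clm_ext_monomial {S T : L2 →L[ℂ] L2} (h : ∀ n, S (monomial n) = T (monomial n)) :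
    S = T :=
  ContinuousLinearMap.ext_on dense_span_monomial (by rintro _ ⟨n, rfl⟩; exact h n)

/-- Vectors with the same Fourier coefficients are equal. -/
theorem ext_inner_monomial {x y : L2} (h : ∀ n, ⟪monomial n, x⟫_ℂ = ⟪monomial n, y⟫_ℂ) :
    x = y := by
  refine (fourierBasis (T := 2 * π)).repr.injective ?_
  ext n
  rw [HilbertBasis.repr_apply_apply, HilbertBasis.repr_apply_apply, coe_fourierBasis]
  exact h n

theorem mem_hardyTwo {x : L2} : x ∈ hardyTwo ↔ ∀ n < 0, ⟪monomial n, x⟫_ℂ = 0 := by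
  simp only [inner_monomial_left]
  rfl

theorem Pplus_eq_self {x : L2} (hx : x ∈ hardyTwo) : Pplus x = x :=
  Submodule.starProjection_eq_self_iff.2 hx

theorem Pplus_monomial (n : ℤ) : Pplus (monomial n) = if 0 ≤ n then monomial n else 0 := by
  split_ifs with h
  · refine Pplus_eq_self (mem_hardyTwo.2 fun m hm => ?_)
    rw [inner_monomial, if_neg (by lia)]
  · refine (Submodule.starProjection_apply_eq_zero_iff _).2 ?_
    refine (Submodule.mem_orthogonal' _ _).2 fun y hy => ?_
    exact mem_hardyTwo.1 hy n (not_le.1 h)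

theorem Pminus_monomial (n : ℤ) : Pminus (monomial n) = if 0 ≤ n then 0 else monomial n := by
  rw [Pminus, sub_apply, Pplus_monomial]
  split_ifs <;> simp

theorem inner_Pplus_left (x y : L2) : ⟪Pplus x, y⟫_ℂ = ⟪x, Pplus y⟫_ℂ := by
  conv_lhs => rw [← Pplus_star, ContinuousLinearMap.star_eq_adjoint]
  exact ContinuousLinearMap.adjoint_inner_left _ _ _

theorem inner_Pminus_left (x y : L2) : ⟪Pminus x, y⟫_ℂ = ⟪x, Pminus y⟫_ℂ := by
  simp [Pminus, inner_sub_left, inner_sub_right, inner_Pplus_left]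

theorem Pplus_eq_zero {x : L2} (hx : ∀ n : ℤ, 0 ≤ n → ⟪monomial n, x⟫_ℂ = 0) : Pplus x = 0 := by
  refine ext_inner_monomial fun n => ?_
  rw [← inner_Pplus_left, Pplus_monomial]
  split_ifs with h
  · rw [hx n h, inner_zero_right]
  · simp

theorem Pminus_mul_Pminus : Pminus * Pminus = Pminus := by
  simp [Pminus, mul_sub, sub_mul, Pplus_mul_Pplus]

theorem Pplus_mul_Pminus : Pplus * Pminus = 0 := by
  simp [Pminus, mul_sub, Pplus_mul_Pplus]

theorem Pminus_mul_Pplus : Pminus * Pplus = 0 := by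
  simp [Pminus, sub_mul, Pplus_mul_Pplus]

theorem Pplus_add_Pminus : Pplus + Pminus = 1 := by simp [Pminus]

/-- The matrix of a multiplication operator with respect to the monomials. -/
theorem inner_monomial_mulOp_monomial (f : LInf) (m n : ℤ) :
    ⟪monomial m, mulOp f (monomial n)⟫_ℂ = fourierCoeff (f : Torus → ℂ) (m - n) := by
  rw [inner_monomial_left, fourierCoeff, fourierCoeff]
  refine integral_congr_ae ?_
  filter_upwards [coeFn_mulOp f (monomial n), coeFn_fourierLp (T := 2 * π) 2 n] with t h1 h2
  rw [h1, h2, neg_sub, sub_eq_add_neg, add_comm, fourier_add]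
  simp only [smul_eq_mul]
  ring

/-! ### Compact operators as the closed span of the matrix units -/

open InnerProductSpace in
/-- A closed space of operators that contains the matrix units contains all rank one operators. -/
theorem rankOne_mem_of_monomial {J : Submodule ℂ (L2 →L[ℂ] L2)}
    (hJ : IsClosed (J : Set (L2 →L[ℂ] L2)))
    (h : ∀ m n, rankOne ℂ (monomial m) (monomial n) ∈ J) (x y : L2) : rankOne ℂ x y ∈ J := by
  have h1 : ∀ n, rankOne ℂ x (monomial n) ∈ J := by
    intro n
    let L : L2 →L[ℂ] (L2 →L[ℂ] L2) := (rankOne ℂ (E := L2) (F := L2)).flip (monomial n)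
    have hcl : IsClosed ((J.comap L.toLinearMap : Submodule ℂ L2) : Set L2) :=
      hJ.preimage L.continuous
    have hle : (Submodule.span ℂ (Set.range monomial)).topologicalClosure ≤
        J.comap L.toLinearMap := by
      refine Submodule.topologicalClosure_minimal _ (Submodule.span_le.2 ?_) hcl
      rintro _ ⟨m, rfl⟩
      exact h m n
    rw [topologicalClosure_span_monomial] at hle
    exact hle (Submodule.mem_top (x := x))
  -- The second slot is conjugate linear, but the preimage of a subspace under a semilinear map is
  -- still a subspace, so the same density argument applies.
  let L : L2 →L⋆[ℂ] (L2 →L[ℂ] L2) := rankOne ℂ x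
  have hcl : IsClosed ((J.comap L.toLinearMap : Submodule ℂ L2) : Set L2) :=
    hJ.preimage L.continuous
  have hle : (Submodule.span ℂ (Set.range monomial)).topologicalClosure ≤
      J.comap L.toLinearMap := by
    refine Submodule.topologicalClosure_minimal _ (Submodule.span_le.2 ?_) hcl
    rintro _ ⟨m, rfl⟩
    exact h1 m
  rw [topologicalClosure_span_monomial] at hle
  exact hle (Submodule.mem_top (x := y))

/-- A compact operator is approximated in norm by its compressions to finite dimensional
spaces. -/
theorem exists_starProjection_mul_approx {T : L2 →L[ℂ] L2} (hT : IsCompactOperator T) {ε : ℝ}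
    (hε : 0 < ε) : ∃ (V : Submodule ℂ L2) (_ : FiniteDimensional ℂ V),
      ‖T - V.starProjection * T‖ ≤ ε := by
  have hb := ((isCompactOperator_iff_isCompact_closure_image_closedBall
    T.toLinearMap one_pos).1 hT).totallyBounded.subset subset_closure
  -- A finite `ε`-net of the image of the unit ball spans `V`; the projection onto `V` is at least
  -- as close to `T x` as the net point.
  obtain ⟨t, htf, ht⟩ := Metric.totallyBounded_iff.1 hb ε hε
  have hfin : FiniteDimensional ℂ (Submodule.span ℂ t) := FiniteDimensional.span_of_finite ℂ htf
  refine ⟨Submodule.span ℂ t, hfin, ?_⟩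
  refine ContinuousLinearMap.opNorm_le_of_unit_norm hε.le fun x hx => ?_
  obtain ⟨y, hy, hxy⟩ := Set.mem_iUnion₂.1 (ht ⟨x, mem_closedBall_zero_iff.2 hx.le, rfl⟩)
  rw [mem_ball_iff_norm] at hxy
  change ‖T x - (Submodule.span ℂ t).starProjection (T x)‖ ≤ ε
  rw [Submodule.starProjection_minimal]
  have hbdd : BddBelow (Set.range fun w : Submodule.span ℂ t => ‖T x - w‖) :=
    ⟨0, by rintro _ ⟨w, rfl⟩; exact norm_nonneg _⟩
  exact (ciInf_le hbdd ⟨y, Submodule.subset_span hy⟩).trans hxy.le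

open InnerProductSpace in
/-- The compact operators are the closed span of the matrix units. -/
theorem compacts_le_of_rankOne_monomial_mem {J : Submodule ℂ (L2 →L[ℂ] L2)}
    (hJ : IsClosed (J : Set (L2 →L[ℂ] L2)))
    (h : ∀ m n, rankOne ℂ (monomial m) (monomial n) ∈ J) : compacts ≤ J := by
  intro T hT
  refine hJ.closure_eq.subset (Metric.mem_closure_iff.2 fun ε hε => ?_)
  obtain ⟨V, hV, hTV⟩ := exists_starProjection_mul_approx hT (half_pos hε)
  refine ⟨V.starProjection * T, ?_, by rw [dist_eq_norm]; linarith⟩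
  let b := stdOrthonormalBasis ℂ V
  have : V.starProjection * T = ∑ i, rankOne ℂ (b i : L2) (star T (b i)) := by
    ext1 x
    rw [mul_apply_eq_comp, b.starProjection_eq_sum_rankOne]
    simp [ContinuousLinearMap.star_eq_adjoint, ContinuousLinearMap.adjoint_inner_left]
  rw [this]
  exact Submodule.sum_mem _ fun i _ => rankOne_mem_of_monomial hJ h _ _

theorem isClosed_compacts : IsClosed (compacts : Set (L2 →L[ℂ] L2)) :=
  isClosed_setOfPred_isCompactOperator

open InnerProductSpace in
theorem rankOne_mem_compacts (x y : L2) : rankOne ℂ x y ∈ compacts := by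
  rw [rankOne_def']
  exact IsCompactOperator.comp_clm (isCompactOperator_of_locallyCompactSpace_rng
    (ContinuousLinearMap.toSpanSingleton ℂ x)) (innerSL ℂ y)

theorem mul_mem_compacts_left (S : L2 →L[ℂ] L2) {T : L2 →L[ℂ] L2} (hT : T ∈ compacts) :
    S * T ∈ compacts :=
  IsCompactOperator.clm_comp hT S

theorem mul_mem_compacts_right (S : L2 →L[ℂ] L2) {T : L2 →L[ℂ] L2} (hT : T ∈ compacts) :
    T * S ∈ compacts :=
  IsCompactOperator.comp_clm hT S

theorem star_mem_compacts {T : L2 →L[ℂ] L2} (hT : T ∈ compacts) : star T ∈ compacts :=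
  isCompactOperator_star hT

/-! ### Hankel operators -/

/-- The only matrix entries not killed by the projections have `m < 0 ≤ n`, and they are Fourier
coefficients of `f` of negative index `m - n`. -/
theorem Pminus_mul_mulOp_mul_Pplus_of_mem_hardyInf {f : LInf} (hf : f ∈ hardyInf) :
    Pminus * mulOp f * Pplus = 0 := by
  refine clm_ext_monomial fun n => ext_inner_monomial fun m => ?_
  simp only [mul_apply_eq_comp]
  rw [← inner_Pminus_left, Pminus_monomial, Pplus_monomial]
  split_ifs with hm hn
  · simp
  · simp
  · rw [inner_monomial_mulOp_monomial, hf _ (by lia)]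
    simp
  · simp

-- Multiplication by `zᵏ` carries `zʲ` with `j ≥ 0` to a negative power only when `0 ≤ j < -k`, so
-- the rank is finite.
open InnerProductSpace in
theorem Pminus_mul_contMulOp_fourier_mul_Pplus_mem_compacts (k : ℤ) :
    Pminus * contMulOp (fourier k) * Pplus ∈ compacts := by
  have : Pminus * contMulOp (fourier k) * Pplus =
      ∑ j ∈ Finset.Ico 0 (-k), rankOne ℂ (monomial (k + j)) (monomial j) := by
    refine clm_ext_monomial fun n => ?_
    simp only [mul_apply_eq_comp, sum_apply, rankOne_apply, inner_monomial,
      ite_smul, one_smul, zero_smul, Finset.sum_ite_eq', Finset.mem_Ico]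
    rw [Pplus_monomial]
    split_ifs with h1 h2 h2
    · rw [contMulOp_fourier_monomial, Pminus_monomial, if_neg (by lia)]
    · rw [contMulOp_fourier_monomial, Pminus_monomial, if_pos (by lia)]
    · lia
    · simp
  rw [this]
  exact Submodule.sum_mem _ fun j _ => rankOne_mem_compacts _ _

/-- The Hankel operator of a continuous function is compact. -/
theorem Pminus_mul_contMulOp_mul_Pplus_mem_compacts (f : C(Torus, ℂ)) :
    Pminus * contMulOp f * Pplus ∈ compacts := by
  let L : C(Torus, ℂ) →ₗ[ℂ] (L2 →L[ℂ] L2) :=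
    { toFun f := Pminus * contMulOp f * Pplus
      map_add' f g := by simp [mul_add, add_mul]
      map_smul' c f := by simp }
  have hL : Continuous L := by
    change Continuous fun f : C(Torus, ℂ) => Pminus * contMulOp f * Pplus
    exact (continuous_const.mul contMulOp.continuous).mul continuous_const
  have hle : (Submodule.span ℂ (Set.range (fourier (T := 2 * π)))).topologicalClosure ≤
      compacts.comap L := by
    refine Submodule.topologicalClosure_minimal _ (Submodule.span_le.2 ?_)
      (isClosed_compacts.preimage hL)
    rintro _ ⟨k, rfl⟩
    exact Pminus_mul_contMulOp_fourier_mul_Pplus_mem_compacts k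
  rw [span_fourier_closure_eq_top] at hle
  exact hle (Submodule.mem_top (x := f))

/-- The Hankel operator of a function in `H^∞ + C(𝕋)` is compact. -/
theorem Pminus_mul_mulOp_mul_Pplus_mem_compacts {f : LInf} (hf : f ∈ hardyInfPlusC) :
    Pminus * mulOp f * Pplus ∈ compacts := by
  obtain ⟨h, hh, c, rfl⟩ := hf
  rw [mulOp_add, mul_add, add_mul, Pminus_mul_mulOp_mul_Pplus_of_mem_hardyInf hh, zero_add]
  exact Pminus_mul_contMulOp_mul_Pplus_mem_compacts c

/-- This is the adjoint of the Hankel operator of `star f`; it is why `QC` demands both `f` and its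
conjugate in `H^∞ + C`. -/
theorem Pplus_mul_mulOp_mul_Pminus_mem_compacts {f : LInf} (hf : star f ∈ hardyInfPlusC) :
    Pplus * mulOp f * Pminus ∈ compacts := by
  have := star_mem_compacts (Pminus_mul_mulOp_mul_Pplus_mem_compacts hf)
  rwa [star_mul, star_mul, mulOp_star, star_star, Pplus_star, Pminus_star, ← mul_assoc] at this

/-! ### The semicommutator ideal -/

theorem continuousSymbols_subset_quasicontinuous : continuousSymbols ⊆ quasicontinuous := by
  rintro _ ⟨f, rfl⟩
  exact ⟨contToLInf_mem_hardyInfPlusC f,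
    by rw [star_contToLInf]; exact contToLInf_mem_hardyInfPlusC _⟩

/-- The block diagonal part of `R_H`. -/
def diagOp (f ψ : LInf) : L2 →L[ℂ] L2 :=
  Pplus * mulOp f * Pplus + Pminus * mulOp ψ * Pminus

theorem gsio_sub_diagOp_mem_compacts {f φ g ψ : LInf} (hφ : φ ∈ quasicontinuous)
    (hg : g ∈ quasicontinuous) : gsio !![f, φ; g, ψ] - diagOp f ψ ∈ compacts := by
  have : gsio !![f, φ; g, ψ] - diagOp f ψ =
      Pminus * mulOp g * Pplus + Pplus * mulOp φ * Pminus := by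
    simp only [gsio, diagOp, Matrix.of_apply, Matrix.cons_val', Matrix.cons_val_zero,
      Matrix.cons_val_one, Matrix.cons_val_fin_one]
    abel
  rw [this]
  exact add_mem (Pminus_mul_mulOp_mul_Pplus_mem_compacts hg.1)
    (Pplus_mul_mulOp_mul_Pminus_mem_compacts hφ.2)

/-- Replacing the inner `P₊` by `1 - P₋`, and vice versa, leaves as error terms products whose right
factors are Hankel operators of `f₂` and `ψ₂`. Hence only the second pair of symbols needs to be
quasicontinuous. -/
theorem diagOp_mul_sub_mem_compacts {f₁ ψ₁ f₂ ψ₂ : LInf} (hf : f₂ ∈ quasicontinuous)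
    (hψ : ψ₂ ∈ quasicontinuous) :
    diagOp f₁ ψ₁ * diagOp f₂ ψ₂ - diagOp (f₁ • f₂ : LInf) (ψ₁ • ψ₂ : LInf) ∈ compacts := by
  have key : diagOp f₁ ψ₁ * diagOp f₂ ψ₂ - diagOp (f₁ • f₂ : LInf) (ψ₁ • ψ₂ : LInf) =
      -(Pplus * mulOp f₁ * (Pminus * mulOp f₂ * Pplus) +
        Pminus * mulOp ψ₁ * (Pplus * mulOp ψ₂ * Pminus)) := by
    simp only [diagOp, mulOp_smul_eq_mul, add_mul, mul_add]
    have h1 : Pplus * mulOp f₁ * Pplus * (Pplus * mulOp f₂ * Pplus) =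
        Pplus * mulOp f₁ * (mulOp f₂ * Pplus) - Pplus * mulOp f₁ * (Pminus * mulOp f₂ * Pplus) := by
      rw [← mul_sub, mul_assoc _ Pplus, ← mul_assoc Pplus, ← mul_assoc Pplus, Pplus_mul_Pplus]
      congr 1
      simp [Pminus, sub_mul, mul_assoc]
    have h2 : Pminus * mulOp ψ₁ * Pminus * (Pminus * mulOp ψ₂ * Pminus) =
        Pminus * mulOp ψ₁ * (mulOp ψ₂ * Pminus) -
          Pminus * mulOp ψ₁ * (Pplus * mulOp ψ₂ * Pminus) := by
      rw [← mul_sub, mul_assoc _ Pminus, ← mul_assoc Pminus, ← mul_assoc Pminus,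
        Pminus_mul_Pminus, mul_assoc Pplus, ← one_sub_mul, mul_assoc Pminus]
      rfl
    have h3 : Pplus * mulOp f₁ * Pplus * (Pminus * mulOp ψ₂ * Pminus) = 0 := by
      rw [mul_assoc _ Pplus, ← mul_assoc Pplus, ← mul_assoc Pplus, Pplus_mul_Pminus]
      simp
    have h4 : Pminus * mulOp ψ₁ * Pminus * (Pplus * mulOp f₂ * Pplus) = 0 := by
      rw [mul_assoc _ Pminus, ← mul_assoc Pminus, ← mul_assoc Pminus, Pminus_mul_Pplus]
      simp
    rw [h1, h2, h3, h4]
    simp only [← mul_assoc]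
    abel
  rw [key]
  exact neg_mem (add_mem
    (mul_mem_compacts_left _ (Pminus_mul_mulOp_mul_Pplus_mem_compacts hf.1))
    (mul_mem_compacts_left _ (Pplus_mul_mulOp_mul_Pminus_mem_compacts hψ.2)))

/-- Semicommutators with quasicontinuous symbols are compact. -/
theorem semicommutators_subset_compacts {A : Set LInf} (hA : A ⊆ quasicontinuous) :
    semicommutators A ⊆ compacts := by
  rintro _ ⟨f₁, hf₁, g₁, hg₁, φ₁, hφ₁, ψ₁, hψ₁, f₂, hf₂, g₂, hg₂, φ₂, hφ₂, ψ₂, hψ₂, g, hg, φ, hφ,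
    rfl⟩
  have h1 := gsio_sub_diagOp_mem_compacts (f := f₁) (ψ := ψ₁) (hA hφ₁) (hA hg₁)
  have h2 := gsio_sub_diagOp_mem_compacts (f := f₂) (ψ := ψ₂) (hA hφ₂) (hA hg₂)
  have h3 := gsio_sub_diagOp_mem_compacts (f := (f₁ • f₂ : LInf)) (ψ := (ψ₁ • ψ₂ : LInf))
    (hA hφ) (hA hg)
  have h4 := diagOp_mul_sub_mem_compacts (f₁ := f₁) (ψ₁ := ψ₁) (hA hf₂) (hA hψ₂)
  generalize gsio !![f₁, φ₁; g₁, ψ₁] = R₁ at *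
  generalize gsio !![f₂, φ₂; g₂, ψ₂] = R₂ at *
  generalize gsio !![(f₁ • f₂ : LInf), φ; g, (ψ₁ • ψ₂ : LInf)] = R₃ at *
  -- Each factor is exchanged for its block diagonal part, one at a time.
  have : R₁ * R₂ - R₃ = (R₁ - diagOp f₁ ψ₁) * R₂ + diagOp f₁ ψ₁ * (R₂ - diagOp f₂ ψ₂) +
      (diagOp f₁ ψ₁ * diagOp f₂ ψ₂ - diagOp (f₁ • f₂ : LInf) (ψ₁ • ψ₂ : LInf)) -
      (R₃ - diagOp (f₁ • f₂ : LInf) (ψ₁ • ψ₂ : LInf)) := by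
    noncomm_ring
  rw [this]
  exact sub_mem (add_mem (add_mem (mul_mem_compacts_right _ h1) (mul_mem_compacts_left _ h2)) h4) h3

/-- This puts every multiplication operator with symbol in `A` into `R_A`, which supplies the shifts
that move matrix units around. -/
theorem gsio_eq_mulOp (f : LInf) : gsio !![f, f; f, f] = mulOp f := by
  simp only [gsio, Matrix.of_apply, Matrix.cons_val', Matrix.cons_val_zero,
      Matrix.cons_val_one, Matrix.cons_val_fin_one, Pminus]
  noncomm_ring

theorem gsio_mem_gsioAlgebra {A : Set LInf} {f φ g ψ : LInf} (hf : f ∈ A) (hφ : φ ∈ A)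
    (hg : g ∈ A) (hψ : ψ ∈ A) : gsio !![f, φ; g, ψ] ∈ gsioAlgebra A := by
  refine StarSubalgebra.le_topologicalClosure _ (StarAlgebra.subset_adjoin ℂ _ ⟨_, ?_, rfl⟩)
  intro i j
  fin_cases i <;> fin_cases j <;> assumption

theorem contMulOp_mem_gsioAlgebra {A : Set LInf} (hA : continuousSymbols ⊆ A) (f : C(Torus, ℂ)) :
    contMulOp f ∈ gsioAlgebra A := by
  rw [← mulOp_contToLInf, ← gsio_eq_mulOp]
  have hf : contToLInf f ∈ A := hA ⟨f, rfl⟩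
  exact gsio_mem_gsioAlgebra hf hf hf hf

open InnerProductSpace in
/-- The semicommutator of `z` and `z̄` is, up to sign, the projection onto the constants. -/
theorem gsio_mul_gsio_sub_gsio_eq_neg_rankOne :
    gsio !![contToLInf (fourier 1), 0; 0, 0] * gsio !![contToLInf (fourier (-1)), 0; 0, 0] -
      gsio !![(contToLInf (fourier 1) • contToLInf (fourier (-1)) : LInf), 0; 0,
        ((0 : LInf) • (0 : LInf) : LInf)] = -rankOne ℂ (monomial 0) (monomial 0) := by
  have h0 : ((0 : LInf) • (0 : LInf) : LInf) = 0 := by simp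
  have h1 : (fourier 1 * fourier (-1) : C(Torus, ℂ)) = 1 := by
    ext t
    rw [ContinuousMap.mul_apply, ← fourier_add]
    simp
  rw [h0, contToLInf_smul, h1]
  simp only [gsio, Matrix.of_apply, Matrix.cons_val', Matrix.cons_val_zero,
      Matrix.cons_val_one, Matrix.cons_val_fin_one, mulOp_zero, mulOp_contToLInf, contMulOp_one,
      mul_zero, zero_mul, add_zero, mul_one, Pplus_mul_Pplus]
  refine clm_ext_monomial fun n => ?_
  simp only [sub_apply, neg_apply, mul_apply_eq_comp, rankOne_apply, inner_monomial]
  rw [Pplus_monomial]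
  -- The index `0` is special: `z̄` sends the constant to index `-1`, where `P₊` kills it, whereas
  -- `zⁿ` with `n > 0` survives and is restored by `z`.
  rcases lt_trichotomy n 0 with h | rfl | h
  · simp [h.ne', not_le.2 h]
  · simp [contMulOp_fourier_monomial, Pplus_monomial]
  · simp only [h.le, if_true, contMulOp_fourier_monomial, Pplus_monomial, h.ne, if_false,
      zero_smul, neg_zero, if_pos (show 0 ≤ -1 + n by lia)]
    rw [show 1 + (-1 + n) = n by ring, if_pos h.le, sub_self]

open InnerProductSpace in
theorem neg_rankOne_mem_semicommutators {A : Set LInf} (hA : continuousSymbols ⊆ A) :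
    (-rankOne ℂ (monomial 0) (monomial 0) : L2 →L[ℂ] L2) ∈ semicommutators A := by
  have h0 : (0 : LInf) ∈ A := hA ⟨0, map_zero _⟩
  exact ⟨_, hA ⟨_, rfl⟩, 0, h0, 0, h0, 0, h0, _, hA ⟨_, rfl⟩, 0, h0, 0, h0, 0, h0, 0, h0, 0, h0,
    gsio_mul_gsio_sub_gsio_eq_neg_rankOne.symm⟩

open InnerProductSpace in
/-- A closed space of operators that is stable under multiplication by continuous functions on
both sides and contains the projection onto the constants contains all compact operators. -/
theorem compacts_le_of_rankOne_zero_mem {J : Submodule ℂ (L2 →L[ℂ] L2)}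
    (hJ : IsClosed (J : Set (L2 →L[ℂ] L2)))
    (hl : ∀ f : C(Torus, ℂ), ∀ T ∈ J, contMulOp f * T ∈ J)
    (hr : ∀ f : C(Torus, ℂ), ∀ T ∈ J, T * contMulOp f ∈ J)
    (h : rankOne ℂ (monomial 0) (monomial 0) ∈ J) : compacts ≤ J := by
  refine compacts_le_of_rankOne_monomial_mem hJ fun m n => ?_
  have : (rankOne ℂ (monomial m) (monomial n) : L2 →L[ℂ] L2) =
      contMulOp (fourier m) * rankOne ℂ (monomial 0) (monomial 0) * contMulOp (fourier (-n)) := by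
    refine clm_ext_monomial fun k => ?_
    simp only [mul_apply_eq_comp, rankOne_apply, contMulOp_fourier_monomial, inner_monomial,
      map_smul, add_zero]
    congr 1
    split_ifs <;> first | rfl | lia
  rw [this]
  exact hr _ _ (hl _ _ h)

theorem compacts_le_of_isClosedIdeal {A : Set LInf} (hA : continuousSymbols ⊆ A)
    {J : Submodule ℂ (L2 →L[ℂ] L2)} (hJ : IsClosedIdeal (gsioAlgebra A) J)
    (hs : semicommutators A ⊆ J) : compacts ≤ J := by
  refine compacts_le_of_rankOne_zero_mem hJ.isClosed
    (fun f T hT => hJ.mul_left _ (contMulOp_mem_gsioAlgebra hA f) T hT)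
    (fun f T hT => hJ.mul_right _ (contMulOp_mem_gsioAlgebra hA f) T hT) ?_
  exact neg_mem_iff.1 (hs (neg_rankOne_mem_semicommutators hA))

theorem isClosed_gsioAlgebra (A : Set LInf) :
    IsClosed (gsioAlgebra A : Set (L2 →L[ℂ] L2)) :=
  StarSubalgebra.isClosed_topologicalClosure _

/-- Besides the inclusion in the exact sequence, this makes `𝒦` one of the ideals over which the
semicommutator ideal is the infimum. -/
theorem mem_gsioAlgebra_of_mem_compacts {A : Set LInf} (hA : continuousSymbols ⊆ A) :
    ∀ T ∈ compacts, T ∈ gsioAlgebra A := by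
  have hle : compacts ≤ Subalgebra.toSubmodule (gsioAlgebra A).toSubalgebra := by
    refine compacts_le_of_rankOne_zero_mem (isClosed_gsioAlgebra A)
      (fun f T hT => (gsioAlgebra A).mul_mem (contMulOp_mem_gsioAlgebra hA f) hT)
      (fun f T hT => (gsioAlgebra A).mul_mem hT (contMulOp_mem_gsioAlgebra hA f)) ?_
    have h0 : (0 : LInf) ∈ A := hA ⟨0, map_zero _⟩
    have hs : ((0 : LInf) • (0 : LInf) : LInf) ∈ A := by simpa using h0
    refine neg_mem_iff.1 ?_
    rw [← gsio_mul_gsio_sub_gsio_eq_neg_rankOne]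
    have hc : ∀ f, contToLInf f ∈ A := fun f => hA ⟨f, rfl⟩
    refine sub_mem (mul_mem (S := StarSubalgebra ℂ (L2 →L[ℂ] L2)) (s := gsioAlgebra A)
      (gsio_mem_gsioAlgebra (hc _) h0 h0 h0)
      (gsio_mem_gsioAlgebra (hc _) h0 h0 h0)) (gsio_mem_gsioAlgebra ?_ h0 h0 hs)
    rw [contToLInf_smul]
    exact hc _
  exact fun T hT => hle hT

/-- The semicommutator ideal consists of the compact operators for every class of
quasicontinuous symbols that contains the continuous ones. -/
theorem semicommutatorIdeal_eq_compacts {A : Set LInf} (hA : continuousSymbols ⊆ A)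
    (hA' : A ⊆ quasicontinuous) : semicommutatorIdeal A = compacts := by
  refine le_antisymm (sInf_le ⟨⟨mem_gsioAlgebra_of_mem_compacts hA, isClosed_compacts,
    fun S _ T hT => mul_mem_compacts_left S hT, fun S _ T hT => mul_mem_compacts_right S hT⟩,
    semicommutators_subset_compacts hA'⟩) ?_
  exact le_sInf fun J hJ => compacts_le_of_isClosedIdeal hA hJ.1 hJ.2

/-! ### Reproducing kernels and their Poisson moments -/

theorem inner_contMulOp_right (f : C(Torus, ℂ)) (x y : L2) :
    ⟪x, contMulOp f y⟫_ℂ = ⟪contMulOp (star f) x, y⟫_ℂ := by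
  rw [contMulOp_star, ContinuousLinearMap.star_eq_adjoint, ContinuousLinearMap.adjoint_inner_left]

theorem star_fourier (n : ℤ) : star (fourier n : C(Torus, ℂ)) = fourier (-n) := by
  ext t
  rw [fourier_neg]
  rfl

theorem kernelPlus_eq {w : ℂ} (hw : ‖w‖ < 1) : kernelPlus w = contToL2 (kernelFun w hw) :=
  dif_pos hw

theorem kernelMinus_eq {w : ℂ} (hw : ‖w‖ < 1) :
    kernelMinus w = contToL2 (star (fourier 1 * kernelFun w hw)) :=
  dif_pos hw

/-- This is `(1 - w̄ z) k_w = √(1 - |w|²)`. Every inner product with `k_w` below is computed from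
this recursion, without the geometric series. -/
theorem kernelFun_eq_add {w : ℂ} (hw : ‖w‖ < 1) :
    kernelFun w hw = (√(1 - ‖w‖ ^ 2) : ℂ) • fourier 0 + conj w • (fourier 1 * kernelFun w hw) := by
  ext t
  have hne : 1 - conj w * fourier 1 t ≠ 0 := by
    intro h
    have h1 : ‖conj w * fourier 1 t‖ = 1 := by rw [← sub_eq_zero.1 h]; simp
    rw [norm_mul, RCLike.norm_conj, fourier_apply, Circle.norm_coe, mul_one] at h1
    exact hw.ne h1
  simp only [kernelFun, ContinuousMap.add_apply, ContinuousMap.smul_apply, ContinuousMap.mul_apply,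
    ContinuousMap.coe_mk, fourier_zero, smul_eq_mul, mul_one]
  field_simp
  ring

theorem kernelPlus_eq_add {w : ℂ} (hw : ‖w‖ < 1) :
    kernelPlus w = (√(1 - ‖w‖ ^ 2) : ℂ) • monomial 0 +
      conj w • contMulOp (fourier 1) (kernelPlus w) := by
  rw [kernelPlus_eq hw, contMulOp_contToL2]
  conv_lhs => rw [kernelFun_eq_add hw, contToL2, map_add, map_smul, map_smul]

theorem inner_monomial_kernelPlus {w : ℂ} (hw : ‖w‖ < 1) (n : ℤ) :
    ⟪monomial n, kernelPlus w⟫_ℂ = (if n = 0 then (√(1 - ‖w‖ ^ 2) : ℂ) else 0) +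
      conj w * ⟪monomial (n - 1), kernelPlus w⟫_ℂ := by
  conv_lhs => rw [kernelPlus_eq_add hw]
  rw [inner_add_right, inner_smul_right, inner_smul_right, inner_contMulOp_right, star_fourier,
    contMulOp_fourier_monomial, inner_monomial, neg_add_eq_sub]
  simp

/-- Below index zero the recursion has no constant term, so descending `m` steps bounds the
coefficient by `|w|ᵐ ‖k_w‖`, which tends to zero. -/
theorem inner_monomial_kernelPlus_of_neg {w : ℂ} (hw : ‖w‖ < 1) {n : ℤ} (hn : n < 0) :
    ⟪monomial n, kernelPlus w⟫_ℂ = 0 := by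
  have h : ∀ m : ℕ, ⟪monomial n, kernelPlus w⟫_ℂ =
      conj w ^ m * ⟪monomial (n - m), kernelPlus w⟫_ℂ := by
    intro m
    induction m with
    | zero => simp
    | succ m ih =>
      rw [ih, inner_monomial_kernelPlus hw (n - m), if_neg (by lia), zero_add, pow_succ,
        mul_assoc, Nat.cast_succ, sub_sub]
  have hb : ∀ m : ℕ, ‖⟪monomial n, kernelPlus w⟫_ℂ‖ ≤ ‖w‖ ^ m * ‖kernelPlus w‖ := by
    intro m
    rw [h m, norm_mul, norm_pow, RCLike.norm_conj]
    gcongr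
    refine (norm_inner_le_norm _ _).trans ?_
    rw [orthonormal_monomial.1, one_mul]
  have hlim : Tendsto (fun m : ℕ => ‖w‖ ^ m * ‖kernelPlus w‖) atTop (𝓝 0) := by
    simpa using (tendsto_pow_atTop_nhds_zero_of_lt_one (norm_nonneg w) hw).mul_const _
  exact norm_le_zero_iff.1 (ge_of_tendsto' hlim hb)

/-- The bound is uniform in `n` and vanishes as `|w| → 1`; it gives weak convergence of the kernels
to zero. -/
theorem norm_inner_monomial_kernelPlus_le {w : ℂ} (hw : ‖w‖ < 1) (n : ℤ) :
    ‖⟪monomial n, kernelPlus w⟫_ℂ‖ ≤ √(1 - ‖w‖ ^ 2) := by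
  rcases lt_or_ge n 0 with hn | hn
  · rw [inner_monomial_kernelPlus_of_neg hw hn, norm_zero]
    positivity
  lift n to ℕ using hn
  induction n with
  | zero =>
    rw [inner_monomial_kernelPlus hw, inner_monomial_kernelPlus_of_neg hw (by simp)]
    simp [abs_of_nonneg (Real.sqrt_nonneg _)]
  | succ n ih =>
    rw [inner_monomial_kernelPlus hw, if_neg (by lia), zero_add, norm_mul, RCLike.norm_conj]
    rw [show ((n + 1 : ℕ) : ℤ) - 1 = n by simp]
    exact (mul_le_of_le_one_left (norm_nonneg _) hw.le).trans ih

theorem inner_contMulOp_fourier_fourier (m n : ℤ) (x y : L2) :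
    ⟪contMulOp (fourier m) x, contMulOp (fourier n) y⟫_ℂ =
      ⟪x, contMulOp (fourier (n - m)) y⟫_ℂ := by
  have h : (fourier (n - m) : C(Torus, ℂ)) = star (fourier m) * fourier n := by
    rw [star_fourier]
    ext t
    rw [ContinuousMap.mul_apply, ← fourier_add, neg_add_eq_sub]
  rw [h, contMulOp_mul, mul_apply_eq_comp, inner_contMulOp_right (star _), star_star]

theorem contMulOp_fourier_zero : contMulOp (fourier 0) = 1 := by
  have : (fourier 0 : C(Torus, ℂ)) = 1 := by ext; simp
  rw [this, contMulOp_one]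

theorem inner_kernelPlus_contMulOp_fourier {w : ℂ} (hw : ‖w‖ < 1) (n : ℤ) :
    ⟪kernelPlus w, contMulOp (fourier n) (kernelPlus w)⟫_ℂ =
      √(1 - ‖w‖ ^ 2) * ⟪monomial (-n), kernelPlus w⟫_ℂ +
        w * ⟪kernelPlus w, contMulOp (fourier (n - 1)) (kernelPlus w)⟫_ℂ := by
  conv_lhs => enter [2]; rw [kernelPlus_eq_add hw]
  rw [inner_add_left, inner_smul_left, inner_smul_left, inner_contMulOp_fourier_fourier,
    inner_contMulOp_right, star_fourier, contMulOp_fourier_monomial]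
  simp

/-- Inserting the functional equation in either slot, and using that `z k_w` is orthogonal to the
constants, gives `(1 - |w|²) ‖k_w‖² = 1 - |w|²`. -/
theorem inner_kernelPlus_self {w : ℂ} (hw : ‖w‖ < 1) : ⟪kernelPlus w, kernelPlus w⟫_ℂ = 1 := by
  have hs : (√(1 - ‖w‖ ^ 2) : ℂ) * √(1 - ‖w‖ ^ 2) = 1 - ‖w‖ ^ 2 := by
    have h0 : 0 ≤ 1 - ‖w‖ ^ 2 := by nlinarith [norm_nonneg w]
    rw [← Complex.ofReal_mul, Real.mul_self_sqrt h0]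
    push_cast
    rfl
  have hww : w * conj w = (‖w‖ : ℂ) ^ 2 := RCLike.mul_conj w
  have h0 := inner_kernelPlus_contMulOp_fourier hw 0
  have h1 := inner_contMulOp_fourier_fourier 1 0 (kernelPlus w) (kernelPlus w)
  have hc := inner_monomial_kernelPlus hw 0
  rw [inner_monomial_kernelPlus_of_neg hw (n := 0 - 1) (by lia)] at hc
  rw [contMulOp_fourier_zero, one_apply_eq_self] at h0 h1
  have h2 : ⟪contMulOp (fourier 1) (kernelPlus w), kernelPlus w⟫_ℂ =
      conj w * ⟪kernelPlus w, kernelPlus w⟫_ℂ := by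
    conv_lhs => enter [3]; rw [kernelPlus_eq_add hw]
    rw [inner_add_right, inner_smul_right, inner_smul_right, inner_contMulOp_fourier_fourier,
      sub_self, contMulOp_fourier_zero, one_apply_eq_self, ← inner_conj_symm, inner_contMulOp_right,
      star_fourier, contMulOp_fourier_monomial, inner_monomial_kernelPlus_of_neg hw (by lia)]
    simp
  rw [neg_zero, hc, ← h1, h2] at h0
  have hne : (1 - ‖w‖ ^ 2 : ℂ) ≠ 0 := by
    have : 1 - ‖w‖ ^ 2 ≠ 0 := by nlinarith [norm_nonneg w]
    exact_mod_cast this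
  refine mul_left_cancel₀ hne ?_
  simp only [if_true, mul_zero, add_zero, hs] at h0
  linear_combination h0 + ⟪kernelPlus w, kernelPlus w⟫_ℂ * hww

/-- For positive powers the coefficient of negative index in the recursion drops out, leaving a
factor `w` at each step. -/
theorem inner_kernelPlus_contMulOp_fourier_natCast {w : ℂ} (hw : ‖w‖ < 1) (n : ℕ) :
    ⟪kernelPlus w, contMulOp (fourier n) (kernelPlus w)⟫_ℂ = w ^ n := by
  induction n with
  | zero =>
    rw [Nat.cast_zero, contMulOp_fourier_zero, one_apply_eq_self, inner_kernelPlus_self hw, pow_zero]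
  | succ n ih =>
    rw [inner_kernelPlus_contMulOp_fourier hw, inner_monomial_kernelPlus_of_neg hw (by lia),
      show ((n + 1 : ℕ) : ℤ) - 1 = n by simp, ih]
    ring

theorem inner_kernelPlus_contMulOp_fourier_neg_natCast {w : ℂ} (hw : ‖w‖ < 1) (n : ℕ) :
    ⟪kernelPlus w, contMulOp (fourier (-n)) (kernelPlus w)⟫_ℂ = conj w ^ n := by
  rw [inner_contMulOp_right, star_fourier, neg_neg, ← inner_conj_symm,
    inner_kernelPlus_contMulOp_fourier_natCast hw, map_pow]

/-! ### The kernels of the complement of `H²` -/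

/-- Conjugation reverses the Fourier indices and the factor `z̄` shifts by one, so index `0` of
`k_w` corresponds to `-1`. -/
theorem inner_monomial_kernelMinus {w : ℂ} (hw : ‖w‖ < 1) (n : ℤ) :
    ⟪monomial n, kernelMinus w⟫_ℂ = conj ⟪monomial (-n - 1), kernelPlus w⟫_ℂ := by
  rw [kernelPlus_eq hw, kernelMinus_eq hw]
  simp only [monomial, fourierLp, contToL2]
  rw [ContinuousMap.inner_toLp, ContinuousMap.inner_toLp, ← integral_conj]
  congr 1
  ext t
  simp only [ContinuousMap.star_apply, ContinuousMap.mul_apply, map_mul, Complex.conj_conj,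
    RCLike.star_def]
  rw [← fourier_neg, ← fourier_neg, show -n - 1 = -n + -1 by ring, fourier_add]
  ring

/-- Both vectors have the same modulus on the circle, so they define the same state on
multiplication operators. -/
theorem inner_kernelMinus_contMulOp {w : ℂ} (f : C(Torus, ℂ)) :
    ⟪kernelMinus w, contMulOp f (kernelMinus w)⟫_ℂ =
      ⟪kernelPlus w, contMulOp f (kernelPlus w)⟫_ℂ := by
  by_cases hw : ‖w‖ < 1
  · rw [kernelPlus_eq hw, kernelMinus_eq hw, contMulOp_contToL2, contMulOp_contToL2]
    simp only [contToL2]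
    rw [ContinuousMap.inner_toLp, ContinuousMap.inner_toLp]
    congr 1
    ext t
    simp only [ContinuousMap.star_apply, ContinuousMap.mul_apply, map_mul, Complex.conj_conj,
      RCLike.star_def]
    have : conj (fourier 1 t) * (fourier 1 t : ℂ) = 1 := by
      rw [← fourier_neg, ← fourier_add]
      simp
    linear_combination (f t * kernelFun w hw t * conj (kernelFun w hw t)) * this
  · simp [kernelPlus, kernelMinus, hw]

/-- An inequality suffices, and it also covers the default value `0` outside the disc, so the limits
need no side condition on `r`. -/
theorem norm_kernelPlus_le (w : ℂ) : ‖kernelPlus w‖ ≤ 1 := by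
  by_cases hw : ‖w‖ < 1
  · have h := inner_kernelPlus_self hw
    rw [inner_self_eq_norm_sq_to_K] at h
    have h' : ‖kernelPlus w‖ ^ 2 = 1 := Complex.ofReal_injective (by simpa using h)
    nlinarith [norm_nonneg (kernelPlus w)]
  · simp [kernelPlus, hw]

theorem norm_kernelMinus_eq (w : ℂ) : ‖kernelMinus w‖ = ‖kernelPlus w‖ := by
  have h := inner_kernelMinus_contMulOp (w := w) 1
  rw [contMulOp_one, one_apply_eq_self, one_apply_eq_self, inner_self_eq_norm_sq_to_K,
    inner_self_eq_norm_sq_to_K] at h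
  have h' : ‖kernelMinus w‖ ^ 2 = ‖kernelPlus w‖ ^ 2 := by exact_mod_cast h
  exact (sq_eq_sq₀ (norm_nonneg _) (norm_nonneg _)).1 h'

theorem Pplus_kernelPlus (w : ℂ) : Pplus (kernelPlus w) = kernelPlus w := by
  by_cases hw : ‖w‖ < 1
  · exact Pplus_eq_self (mem_hardyTwo.2 fun n hn => inner_monomial_kernelPlus_of_neg hw hn)
  · simp [kernelPlus, hw]

theorem Pplus_kernelMinus (w : ℂ) : Pplus (kernelMinus w) = 0 := by
  by_cases hw : ‖w‖ < 1
  · refine Pplus_eq_zero fun n hn => ?_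
    rw [inner_monomial_kernelMinus hw, inner_monomial_kernelPlus_of_neg hw (by lia), map_zero]
  · simp [kernelMinus, hw]

theorem Pminus_kernelPlus (w : ℂ) : Pminus (kernelPlus w) = 0 := by
  simp [Pminus, Pplus_kernelPlus]

theorem Pminus_kernelMinus (w : ℂ) : Pminus (kernelMinus w) = kernelMinus w := by
  simp [Pminus, Pplus_kernelMinus]

/-! ### Radial limits -/

/-- The Lipschitz bound is uniform in `i`, so an `ε/3` argument applies. It reduces limits to the
monomials and to the matrix units. -/
theorem isClosed_setOf_tendsto_of_lipschitz {ι E : Type*} [SeminormedAddCommGroup E]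
    {l : Filter ι} {F : ι → E → ℂ} {G : E → ℂ} (hF : ∀ i x y, ‖F i x - F i y‖ ≤ ‖x - y‖)
    (hG : ∀ x y, ‖G x - G y‖ ≤ ‖x - y‖) :
    IsClosed {x | Tendsto (fun i => F i x) l (𝓝 (G x))} := by
  refine isClosed_of_closure_subset fun x hx => ?_
  refine Metric.tendsto_nhds.2 fun ε hε => ?_
  obtain ⟨y, hy, hxy⟩ := Metric.mem_closure_iff.1 hx (ε / 3) (by positivity)
  filter_upwards [Metric.tendsto_nhds.1 hy (ε / 3) (by positivity)] with i hi
  rw [dist_eq_norm] at hxy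
  have h1 : dist (F i x) (F i y) ≤ ‖x - y‖ := by rw [dist_eq_norm]; exact hF i x y
  have h2 : dist (G y) (G x) ≤ ‖x - y‖ := by rw [dist_comm, dist_eq_norm]; exact hG x y
  linarith [dist_triangle4 (F i x) (F i y) (G y) (G x)]

theorem norm_inner_apply_le {v : L2} (hv : ‖v‖ ≤ 1) (T : L2 →L[ℂ] L2) : ‖⟪v, T v⟫_ℂ‖ ≤ ‖T‖ := by
  calc ‖⟪v, T v⟫_ℂ‖ ≤ ‖v‖ * ‖T v‖ := norm_inner_le_norm _ _
    _ ≤ 1 * (‖T‖ * 1) := by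
        gcongr
        exact T.le_of_opNorm_le_of_le le_rfl hv
    _ = ‖T‖ := by ring

/-- Evaluation at `ξ` is the limit of the vector states of a family `v` as soon as this holds for
the monomials. -/
theorem tendsto_inner_contMulOp {ι : Type*} {l : Filter ι} {v : ι → L2} (hv : ∀ i, ‖v i‖ ≤ 1)
    {ξ : Torus}
    (h : ∀ n, Tendsto (fun i => ⟪v i, contMulOp (fourier n) (v i)⟫_ℂ) l (𝓝 (fourier n ξ)))
    (f : C(Torus, ℂ)) :
    Tendsto (fun i => ⟪v i, contMulOp f (v i)⟫_ℂ) l (𝓝 (f ξ)) := by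
  let J : Submodule ℂ C(Torus, ℂ) :=
    { carrier := {f | Tendsto (fun i => ⟪v i, contMulOp f (v i)⟫_ℂ) l (𝓝 (f ξ))}
      add_mem' := by
        intro f g hf hg
        simpa [inner_add_right] using hf.add hg
      zero_mem' := by simpa using tendsto_const_nhds
      smul_mem' := by
        intro c f hf
        simpa [inner_smul_right] using hf.const_mul c }
  have hJ : IsClosed (J : Set C(Torus, ℂ)) := by
    refine isClosed_setOf_tendsto_of_lipschitz (F := fun i f => ⟪v i, contMulOp f (v i)⟫_ℂ)
      (G := fun f => f ξ) (fun i f g => ?_) fun f g => ?_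
    · rw [← inner_sub_right, ← sub_apply, ← map_sub]
      exact (norm_inner_apply_le (hv i) _).trans (norm_contMulOp_le _)
    · exact (f - g).norm_coe_le_norm ξ
  have hle : (Submodule.span ℂ (Set.range (fourier (T := 2 * π)))).topologicalClosure ≤ J := by
    refine Submodule.topologicalClosure_minimal _ (Submodule.span_le.2 ?_) hJ
    rintro _ ⟨n, rfl⟩
    exact h n
  rw [span_fourier_closure_eq_top] at hle
  exact hle (Submodule.mem_top (x := f))

theorem eventually_norm_ofReal_mul_fourier_lt (ξ : Torus) :
    ∀ᶠ r : ℝ in 𝓝[<] 1, ‖(r : ℂ) * fourier 1 ξ‖ < 1 := by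
  filter_upwards [Ioo_mem_nhdsLT (show (0 : ℝ) < 1 by norm_num)] with r hr
  rw [norm_mul, fourier_apply, Circle.norm_coe, mul_one, Complex.norm_real, Real.norm_eq_abs,
    abs_of_pos hr.1]
  exact hr.2

theorem tendsto_ofReal_mul_fourier (ξ : Torus) :
    Tendsto (fun r : ℝ => (r : ℂ) * fourier 1 ξ) (𝓝[<] 1) (𝓝 (fourier 1 ξ)) := by
  have : Tendsto (fun r : ℝ => (r : ℂ) * fourier 1 ξ) (𝓝 1) (𝓝 ((1 : ℝ) * fourier 1 ξ)) :=
    (Complex.continuous_ofReal.tendsto 1).mul_const _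
  simpa using this.mono_left nhdsWithin_le_nhds

/-- The radial limits of Poisson integrals of continuous functions. -/
theorem tendsto_inner_kernelPlus_contMulOp (f : C(Torus, ℂ)) (ξ : Torus) :
    Tendsto (fun r : ℝ => ⟪kernelPlus (r * fourier 1 ξ),
      contMulOp f (kernelPlus (r * fourier 1 ξ))⟫_ℂ) (𝓝[<] 1) (𝓝 (f ξ)) := by
  refine tendsto_inner_contMulOp (fun r => norm_kernelPlus_le _) (fun n => ?_) f
  have hpow : ∀ m : ℕ, fourier (m : ℤ) ξ = fourier 1 ξ ^ m := by
    intro m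
    rw [fourier_apply, fourier_apply, one_zsmul, natCast_zsmul, toCircle_nsmul, Circle.coe_pow]
  obtain ⟨m, rfl | rfl⟩ := n.eq_nat_or_neg
  · rw [hpow]
    refine Tendsto.congr' ?_ ((tendsto_ofReal_mul_fourier ξ).pow m)
    filter_upwards [eventually_norm_ofReal_mul_fourier_lt ξ] with r hr
    rw [inner_kernelPlus_contMulOp_fourier_natCast hr]
  · rw [fourier_neg, hpow, map_pow]
    refine Tendsto.congr' ?_ (((Complex.continuous_conj.tendsto _).comp
      (tendsto_ofReal_mul_fourier ξ)).pow m)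
    filter_upwards [eventually_norm_ofReal_mul_fourier_lt ξ] with r hr
    rw [inner_kernelPlus_contMulOp_fourier_neg_natCast hr]
    rfl

theorem tendsto_sqrt_one_sub_norm_sq (ξ : Torus) :
    Tendsto (fun r : ℝ => √(1 - ‖(r : ℂ) * fourier 1 ξ‖ ^ 2)) (𝓝[<] 1) (𝓝 0) := by
  have h := ((tendsto_ofReal_mul_fourier ξ).norm.pow 2).const_sub 1 |>.sqrt
  rwa [fourier_apply, Circle.norm_coe, one_pow, sub_self, Real.sqrt_zero] at h

theorem tendsto_inner_monomial_kernelPlus (n : ℤ) (ξ : Torus) :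
    Tendsto (fun r : ℝ => ⟪monomial n, kernelPlus (r * fourier 1 ξ)⟫_ℂ) (𝓝[<] 1) (𝓝 0) := by
  refine squeeze_zero_norm' ?_ (tendsto_sqrt_one_sub_norm_sq ξ)
  filter_upwards [eventually_norm_ofReal_mul_fourier_lt ξ] with r hr
  exact norm_inner_monomial_kernelPlus_le hr n

theorem tendsto_inner_monomial_kernelMinus (n : ℤ) (ξ : Torus) :
    Tendsto (fun r : ℝ => ⟪monomial n, kernelMinus (r * fourier 1 ξ)⟫_ℂ) (𝓝[<] 1) (𝓝 0) := by
  refine squeeze_zero_norm' ?_ (tendsto_sqrt_one_sub_norm_sq ξ)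
  filter_upwards [eventually_norm_ofReal_mul_fourier_lt ξ] with r hr
  rw [inner_monomial_kernelMinus hr, RCLike.norm_conj]
  exact norm_inner_monomial_kernelPlus_le hr _

open InnerProductSpace in
/-- The vector states of a bounded weakly null family vanish in the limit on compact operators. -/
theorem tendsto_inner_of_mem_compacts {ι : Type*} {l : Filter ι} {v : ι → L2}
    (hv : ∀ i, ‖v i‖ ≤ 1) (h : ∀ n, Tendsto (fun i => ⟪monomial n, v i⟫_ℂ) l (𝓝 0))
    {T : L2 →L[ℂ] L2} (hT : T ∈ compacts) : Tendsto (fun i => ⟪v i, T (v i)⟫_ℂ) l (𝓝 0) := by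
  let J : Submodule ℂ (L2 →L[ℂ] L2) :=
    { carrier := {T | Tendsto (fun i => ⟪v i, T (v i)⟫_ℂ) l (𝓝 0)}
      add_mem' := by
        intro S T hS hT
        simpa [inner_add_right] using hS.add hT
      zero_mem' := by simpa using tendsto_const_nhds
      smul_mem' := by
        intro c T hT
        simpa [inner_smul_right] using hT.const_mul c }
  have hJ : IsClosed (J : Set (L2 →L[ℂ] L2)) := by
    refine isClosed_setOf_tendsto_of_lipschitz (E := L2 →L[ℂ] L2)
      (F := fun i T => ⟪v i, T (v i)⟫_ℂ) (G := fun _ => 0) (fun i S T => ?_) fun S T => ?_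
    · simpa only [sub_apply, inner_sub_right] using norm_inner_apply_le (hv i) (S - T)
    · simp
  refine compacts_le_of_rankOne_monomial_mem hJ (fun m n => ?_) hT
  change Tendsto (fun i => ⟪v i, rankOne ℂ (monomial m) (monomial n) (v i)⟫_ℂ) l (𝓝 0)
  simp only [rankOne_apply, inner_smul_right]
  -- On a matrix unit the state factors into two Fourier coefficients of `v i`, each tending to
  -- zero.
  have hm : Tendsto (fun i => ⟪v i, monomial m⟫_ℂ) l (𝓝 0) := by
    simpa [Function.comp_def] using (Complex.continuous_conj.tendsto 0).comp (h m)
  simpa using (h n).mul hm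

/-! ### Block diagonal operators with continuous symbols -/

/-- The operator `P₊ f P₊ + P₋ ψ P₋` of a pair `(f, ψ)` of continuous functions. -/
def symbolOp : C(Torus, ℂ) × C(Torus, ℂ) →ₗ[ℂ] L2 →L[ℂ] L2 where
  toFun a := Pplus * contMulOp a.1 * Pplus + Pminus * contMulOp a.2 * Pminus
  map_add' a b := by
    simp only [Prod.fst_add, Prod.snd_add, map_add, mul_add, add_mul]
    abel
  map_smul' c a := by simp

theorem symbolOp_apply (a : C(Torus, ℂ) × C(Torus, ℂ)) :
    symbolOp a = Pplus * contMulOp a.1 * Pplus + Pminus * contMulOp a.2 * Pminus := rfl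

theorem symbolOp_eq_diagOp (a : C(Torus, ℂ) × C(Torus, ℂ)) :
    symbolOp a = diagOp (contToLInf a.1) (contToLInf a.2) := rfl

theorem symbolOp_star (a : C(Torus, ℂ) × C(Torus, ℂ)) : symbolOp (star a) = star (symbolOp a) := by
  simp only [symbolOp_apply, Prod.fst_star, Prod.snd_star, contMulOp_star, star_add, star_mul,
    Pplus_star, Pminus_star, mul_assoc]

theorem symbolOp_one : symbolOp 1 = 1 := by
  simp [symbolOp_apply, contMulOp_one, Pplus_mul_Pplus, Pminus_mul_Pminus, Pplus_add_Pminus]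

theorem contToLInf_mem_quasicontinuous (f : C(Torus, ℂ)) : contToLInf f ∈ quasicontinuous :=
  continuousSymbols_subset_quasicontinuous ⟨f, rfl⟩

theorem symbolOp_mul_sub_mem_compacts (a b : C(Torus, ℂ) × C(Torus, ℂ)) :
    symbolOp a * symbolOp b - symbolOp (a * b) ∈ compacts := by
  have := diagOp_mul_sub_mem_compacts (f₁ := contToLInf a.1) (ψ₁ := contToLInf a.2)
    (contToLInf_mem_quasicontinuous b.1) (contToLInf_mem_quasicontinuous b.2)
  rwa [contToLInf_smul, contToLInf_smul] at this

theorem norm_add_sq_of_inner_eq_zero {x y : L2} (h : ⟪x, y⟫_ℂ = 0) :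
    ‖x + y‖ ^ 2 = ‖x‖ ^ 2 + ‖y‖ ^ 2 := by
  simpa [pow_two] using norm_add_sq_eq_norm_sq_add_norm_sq_of_inner_eq_zero x y h

theorem inner_Pplus_Pminus (x y : L2) : ⟪Pplus x, Pminus y⟫_ℂ = 0 := by
  rw [inner_Pplus_left, ← mul_apply_eq_comp, Pplus_mul_Pminus]
  simp

theorem norm_sq_eq_Pplus_add_Pminus (x : L2) : ‖x‖ ^ 2 = ‖Pplus x‖ ^ 2 + ‖Pminus x‖ ^ 2 := by
  rw [← norm_add_sq_of_inner_eq_zero (inner_Pplus_Pminus x x)]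
  simp [Pminus]

theorem norm_Pplus_apply_le (x : L2) : ‖Pplus x‖ ≤ ‖x‖ := by
  have := norm_sq_eq_Pplus_add_Pminus x
  exact (sq_le_sq₀ (norm_nonneg _) (norm_nonneg _)).1 (by nlinarith [sq_nonneg ‖Pminus x‖])

theorem norm_Pminus_apply_le (x : L2) : ‖Pminus x‖ ≤ ‖x‖ := by
  have := norm_sq_eq_Pplus_add_Pminus x
  exact (sq_le_sq₀ (norm_nonneg _) (norm_nonneg _)).1 (by nlinarith [sq_nonneg ‖Pplus x‖])

/-- The two blocks have orthogonal domains and orthogonal ranges, so Pythagoras yields the maximum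
of the two norms rather than their sum. -/
theorem norm_symbolOp_le (a : C(Torus, ℂ) × C(Torus, ℂ)) : ‖symbolOp a‖ ≤ ‖a‖ := by
  refine ContinuousLinearMap.opNorm_le_bound _ (norm_nonneg _) fun x => ?_
  refine (sq_le_sq₀ (norm_nonneg _) (by positivity)).1 ?_
  have h : symbolOp a x =
      Pplus (contMulOp a.1 (Pplus x)) + Pminus (contMulOp a.2 (Pminus x)) := rfl
  have h1 : ‖Pplus (contMulOp a.1 (Pplus x))‖ ≤ ‖a‖ * ‖Pplus x‖ :=
    (norm_Pplus_apply_le _).trans ((contMulOp a.1).le_of_opNorm_le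
      ((norm_contMulOp_le _).trans (norm_fst_le a)) _)
  have h2 : ‖Pminus (contMulOp a.2 (Pminus x))‖ ≤ ‖a‖ * ‖Pminus x‖ :=
    (norm_Pminus_apply_le _).trans ((contMulOp a.2).le_of_opNorm_le
      ((norm_contMulOp_le _).trans (norm_snd_le a)) _)
  rw [h, norm_add_sq_of_inner_eq_zero (inner_Pplus_Pminus _ _), mul_pow,
    norm_sq_eq_Pplus_add_Pminus x, mul_add, ← mul_pow, ← mul_pow]
  gcongr

theorem inner_kernelPlus_symbolOp (a : C(Torus, ℂ) × C(Torus, ℂ)) (w : ℂ) :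
    ⟪kernelPlus w, symbolOp a (kernelPlus w)⟫_ℂ =
      ⟪kernelPlus w, contMulOp a.1 (kernelPlus w)⟫_ℂ := by
  rw [symbolOp_apply, add_apply, inner_add_right]
  simp only [mul_apply_eq_comp]
  rw [← inner_Pplus_left, ← inner_Pminus_left, Pplus_kernelPlus, Pminus_kernelPlus,
    inner_zero_left, add_zero]

theorem inner_kernelMinus_symbolOp (a : C(Torus, ℂ) × C(Torus, ℂ)) (w : ℂ) :
    ⟪kernelMinus w, symbolOp a (kernelMinus w)⟫_ℂ =
      ⟪kernelPlus w, contMulOp a.2 (kernelPlus w)⟫_ℂ := by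
  rw [symbolOp_apply, add_apply, inner_add_right]
  simp only [mul_apply_eq_comp]
  rw [← inner_Pplus_left, ← inner_Pminus_left, Pplus_kernelMinus, Pminus_kernelMinus,
    inner_zero_left, zero_add, inner_kernelMinus_contMulOp]

/-- `T` has symbol `a` if it agrees with the block diagonal operator of `a` up to a compact
operator. -/
def HasSymbol (T : L2 →L[ℂ] L2) (a : C(Torus, ℂ) × C(Torus, ℂ)) : Prop :=
  T - symbolOp a ∈ compacts

namespace HasSymbol

variable {S T : L2 →L[ℂ] L2} {a b : C(Torus, ℂ) × C(Torus, ℂ)}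

theorem add (hS : HasSymbol S a) (hT : HasSymbol T b) : HasSymbol (S + T) (a + b) := by
  rw [HasSymbol, map_add, add_sub_add_comm]
  exact add_mem hS hT

theorem sub (hS : HasSymbol S a) (hT : HasSymbol T b) : HasSymbol (S - T) (a - b) := by
  rw [HasSymbol, map_sub, sub_sub_sub_comm]
  exact sub_mem hS hT

theorem mul (hS : HasSymbol S a) (hT : HasSymbol T b) : HasSymbol (S * T) (a * b) := by
  have : S * T - symbolOp (a * b) = (S - symbolOp a) * T + symbolOp a * (T - symbolOp b) +
      (symbolOp a * symbolOp b - symbolOp (a * b)) := by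
    noncomm_ring
  rw [HasSymbol, this]
  exact add_mem (add_mem (mul_mem_compacts_right _ hS) (mul_mem_compacts_left _ hT))
    (symbolOp_mul_sub_mem_compacts a b)

theorem star (hT : HasSymbol T a) : HasSymbol (star T) (star a) := by
  rw [HasSymbol, symbolOp_star, ← star_sub]
  exact star_mem_compacts hT

/-- The block diagonal part contributes the Poisson integral of `a.1`, and the compact remainder
contributes nothing in the limit. -/
theorem tendsto_kernelPlus (hT : HasSymbol T a) (ξ : Torus) :
    Tendsto (fun r : ℝ => ⟪kernelPlus (r * fourier 1 ξ), T (kernelPlus (r * fourier 1 ξ))⟫_ℂ)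
      (𝓝[<] 1) (𝓝 (a.1 ξ)) := by
  have h := (tendsto_inner_kernelPlus_contMulOp a.1 ξ).add (tendsto_inner_of_mem_compacts
    (fun r : ℝ => norm_kernelPlus_le (r * fourier 1 ξ))
    (fun n => tendsto_inner_monomial_kernelPlus n ξ) hT)
  simpa only [← inner_kernelPlus_symbolOp, ← inner_add_right, sub_apply, add_sub_cancel,
    add_zero] using h

theorem tendsto_kernelMinus (hT : HasSymbol T a) (ξ : Torus) :
    Tendsto (fun r : ℝ => ⟪kernelMinus (r * fourier 1 ξ), T (kernelMinus (r * fourier 1 ξ))⟫_ℂ)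
      (𝓝[<] 1) (𝓝 (a.2 ξ)) := by
  have h := (tendsto_inner_kernelPlus_contMulOp a.2 ξ).add (tendsto_inner_of_mem_compacts
    (fun r : ℝ => (norm_kernelMinus_eq (r * fourier 1 ξ)).trans_le (norm_kernelPlus_le _))
    (fun n => tendsto_inner_monomial_kernelMinus n ξ) hT)
  simpa only [← inner_kernelMinus_symbolOp, ← inner_add_right, sub_apply, add_sub_cancel,
    add_zero] using h

/-- Each value of the symbol is a limit of `⟪v, T v⟫` with `‖v‖ ≤ 1`. The bound holds for every
representative modulo `𝒦`, hence also for the quotient norm. -/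
theorem norm_le (hT : HasSymbol T a) : ‖a‖ ≤ ‖T‖ := by
  refine max_le ?_ ?_
  · refine (ContinuousMap.norm_le _ (norm_nonneg _)).2 fun ξ => ?_
    exact le_of_tendsto' (hT.tendsto_kernelPlus ξ).norm fun r =>
      norm_inner_apply_le (norm_kernelPlus_le _) T
  · refine (ContinuousMap.norm_le _ (norm_nonneg _)).2 fun ξ => ?_
    exact le_of_tendsto' (hT.tendsto_kernelMinus ξ).norm fun r =>
      norm_inner_apply_le ((norm_kernelMinus_eq _).trans_le (norm_kernelPlus_le _)) T

theorem unique (ha : HasSymbol T a) (hb : HasSymbol T b) : a = b := by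
  have h := (ha.sub hb).norm_le
  rw [sub_self, norm_zero] at h
  exact sub_eq_zero.1 (norm_le_zero_iff.1 h)

end HasSymbol

theorem hasSymbol_symbolOp (a : C(Torus, ℂ) × C(Torus, ℂ)) : HasSymbol (symbolOp a) a := by
  simp [HasSymbol]

theorem hasSymbol_algebraMap (c : ℂ) :
    HasSymbol (algebraMap ℂ _ c) (algebraMap ℂ (C(Torus, ℂ) × C(Torus, ℂ)) c) := by
  have : symbolOp (algebraMap ℂ (C(Torus, ℂ) × C(Torus, ℂ)) c) = algebraMap ℂ _ c := by
    rw [Algebra.algebraMap_eq_smul_one, Algebra.algebraMap_eq_smul_one, map_smul, symbolOp_one]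
  rw [← this]
  exact hasSymbol_symbolOp _

theorem hasSymbol_zero_iff {T : L2 →L[ℂ] L2} : HasSymbol T 0 ↔ T ∈ compacts := by
  simp [HasSymbol]

theorem hasSymbol_gsio (f φ g ψ : C(Torus, ℂ)) :
    HasSymbol (gsio !![contToLInf f, contToLInf φ; contToLInf g, contToLInf ψ]) (f, ψ) :=
  gsio_sub_diagOp_mem_compacts (contToLInf_mem_quasicontinuous φ)
    (contToLInf_mem_quasicontinuous g)

/-- The operators that have a symbol form a closed set. -/
theorem isClosed_setOf_hasSymbol : IsClosed {T : L2 →L[ℂ] L2 | ∃ a, HasSymbol T a} := by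
  refine isClosed_of_closure_subset fun T hT => ?_
  obtain ⟨u, hu, hlim⟩ := mem_closure_iff_seq_limit.1 hT
  choose a ha using hu
  -- By `norm_le` applied to differences, the symbols converge at least as fast as the operators.
  have hc : CauchySeq a := by
    refine Metric.cauchySeq_iff.2 fun ε hε => ?_
    obtain ⟨N, hN⟩ := Metric.cauchySeq_iff.1 hlim.cauchySeq ε hε
    refine ⟨N, fun m hm n hn => ?_⟩
    rw [dist_eq_norm]
    refine ((ha m).sub (ha n)).norm_le.trans_lt ?_
    rw [← dist_eq_norm]
    exact hN m hm n hn
  obtain ⟨b, hb⟩ := cauchySeq_tendsto_of_complete hc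
  have hcont : Continuous symbolOp :=
    AddMonoidHomClass.continuous_of_bound symbolOp 1 fun a => by simpa using norm_symbolOp_le a
  -- The remainder `T - symbolOp b` is the norm limit of the compact remainders of `u n`.
  exact ⟨b, isClosed_compacts.mem_of_tendsto (hlim.sub ((hcont.tendsto b).comp hb))
    (Eventually.of_forall ha)⟩

/-- The operators that have a symbol, as a C⋆-algebra. -/
def symbolAlgebra : StarSubalgebra ℂ (L2 →L[ℂ] L2) where
  carrier := {T | ∃ a, HasSymbol T a}
  mul_mem' := by
    rintro S T ⟨a, ha⟩ ⟨b, hb⟩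
    exact ⟨_, ha.mul hb⟩
  add_mem' := by
    rintro S T ⟨a, ha⟩ ⟨b, hb⟩
    exact ⟨_, ha.add hb⟩
  algebraMap_mem' c := ⟨_, hasSymbol_algebraMap c⟩
  star_mem' := by
    rintro T ⟨a, ha⟩
    exact ⟨_, ha.star⟩

theorem gsioAlgebra_le_symbolAlgebra : gsioAlgebra continuousSymbols ≤ symbolAlgebra := by
  refine StarSubalgebra.topologicalClosure_minimal (StarAlgebra.adjoin_le ?_)
    isClosed_setOf_hasSymbol
  rintro _ ⟨H, hH, rfl⟩
  choose h hh using hH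
  refine ⟨(h 0 0, h 1 1), ?_⟩
  have : H = !![contToLInf (h 0 0), contToLInf (h 0 1); contToLInf (h 1 0),
      contToLInf (h 1 1)] := by
    ext1 i j
    fin_cases i <;> fin_cases j <;> exact (hh _ _).symm
  rw [this]
  exact hasSymbol_gsio _ _ _ _

theorem symbolOp_mem_gsioAlgebra (a : C(Torus, ℂ) × C(Torus, ℂ)) :
    symbolOp a ∈ gsioAlgebra continuousSymbols := by
  have h0 : (0 : LInf) ∈ continuousSymbols := ⟨0, map_zero _⟩
  have : symbolOp a = gsio !![contToLInf a.1, 0; 0, contToLInf a.2] := by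
    simp [symbolOp_eq_diagOp, diagOp, gsio, mulOp_zero]
  rw [this]
  exact gsio_mem_gsioAlgebra ⟨_, rfl⟩ h0 h0 ⟨_, rfl⟩

/-! ### The symbol homomorphism -/

/-- The symbol of an operator in `R_{C(𝕋)}`. -/
def symbol (T : gsioAlgebra continuousSymbols) : C(Torus, ℂ) × C(Torus, ℂ) :=
  (gsioAlgebra_le_symbolAlgebra T.2).choose

theorem hasSymbol_symbol (T : gsioAlgebra continuousSymbols) : HasSymbol T (symbol T) :=
  (gsioAlgebra_le_symbolAlgebra T.2).choose_spec

theorem symbol_eq {T : gsioAlgebra continuousSymbols} {a : C(Torus, ℂ) × C(Torus, ℂ)}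
    (h : HasSymbol T a) : symbol T = a :=
  (hasSymbol_symbol T).unique h

/-- The symbol map as a `⋆`-homomorphism. -/
def symbolHom : gsioAlgebra continuousSymbols →⋆ₐ[ℂ] C(Torus, ℂ) × C(Torus, ℂ) where
  toFun := symbol
  map_one' := symbol_eq (by
    have h := hasSymbol_algebraMap 1
    rwa [map_one, map_one] at h)
  map_mul' S T := symbol_eq ((hasSymbol_symbol S).mul (hasSymbol_symbol T))
  map_zero' := symbol_eq (by
    have h := hasSymbol_algebraMap 0
    rwa [map_zero, map_zero] at h)
  map_add' S T := symbol_eq ((hasSymbol_symbol S).add (hasSymbol_symbol T))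
  commutes' c := symbol_eq (hasSymbol_algebraMap c)
  map_star' T := symbol_eq (hasSymbol_symbol T).star

theorem hasSymbol_symbolHom (T : gsioAlgebra continuousSymbols) : HasSymbol T (symbolHom T) :=
  hasSymbol_symbol T

theorem symbolHom_eq {T : gsioAlgebra continuousSymbols} {a : C(Torus, ℂ) × C(Torus, ℂ)}
    (h : HasSymbol T a) : symbolHom T = a :=
  symbol_eq h

theorem symbolHom_eq_zero_iff {T : gsioAlgebra continuousSymbols} :
    symbolHom T = 0 ↔ (T : L2 →L[ℂ] L2) ∈ compacts := by
  rw [← hasSymbol_zero_iff]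
  exact ⟨fun h => h ▸ hasSymbol_symbolHom T, symbolHom_eq⟩

theorem symbolHom_surjective : Function.Surjective symbolHom := fun a =>
  ⟨⟨symbolOp a, symbolOp_mem_gsioAlgebra a⟩, symbolHom_eq (hasSymbol_symbolOp a)⟩

/-- The `⋆`-homomorphism induced by the symbol map on the quotient by the compact operators. -/
def quotientSymbolHom :
    (gsioAlgebra continuousSymbols ⧸ compactIdeal (gsioAlgebra continuousSymbols)) →⋆ₐ[ℂ]
      C(Torus, ℂ) × C(Torus, ℂ) where
  toAlgHom := Ideal.Quotient.liftₐ _ symbolHom.toAlgHom fun _ h => symbolHom_eq_zero_iff.2 h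
  map_star' := by
    rintro ⟨T⟩
    exact map_star symbolHom T

theorem quotientSymbolHom_mk (T : gsioAlgebra continuousSymbols) :
    quotientSymbolHom (Ideal.Quotient.mk _ T) = symbolHom T := rfl

theorem quotientSymbolHom_bijective : Function.Bijective quotientSymbolHom := by
  constructor
  · refine (injective_iff_map_eq_zero _).2 fun x hx => ?_
    obtain ⟨T, rfl⟩ := Ideal.Quotient.mk_surjective x
    rw [quotientSymbolHom_mk] at hx
    exact Ideal.Quotient.eq_zero_iff_mem.2 (symbolHom_eq_zero_iff.1 hx)
  · intro a
    obtain ⟨T, rfl⟩ := symbolHom_surjective a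
    exact ⟨Ideal.Quotient.mk _ T, quotientSymbolHom_mk T⟩

/-- One inequality is `norm_le` for representatives of nearly minimal norm; for the other,
`symbolOp` of the symbol is a representative of norm at most that of the symbol. -/
theorem norm_quotientSymbolHom
    (x : gsioAlgebra continuousSymbols ⧸ compactIdeal (gsioAlgebra continuousSymbols)) :
    ‖quotientSymbolHom x‖ = ‖x‖ := by
  refine le_antisymm (le_of_forall_pos_le_add fun ε hε => ?_) ?_
  · obtain ⟨T, rfl, hT⟩ := Submodule.Quotient.norm_mk_lt x hε
    exact (hasSymbol_symbolHom T).norm_le.trans hT.le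
  · obtain ⟨T, rfl⟩ := Ideal.Quotient.mk_surjective x
    have h : (Ideal.Quotient.mk (compactIdeal (gsioAlgebra continuousSymbols)) T) =
        Ideal.Quotient.mk _ ⟨symbolOp (symbolHom T), symbolOp_mem_gsioAlgebra _⟩ :=
      (Ideal.Quotient.mk_eq_mk_iff_sub_mem _ _).2 (hasSymbol_symbolHom T)
    rw [quotientSymbolHom_mk, h]
    exact (Submodule.Quotient.norm_mk_le _ _).trans (norm_symbolOp_le _)

end GSIO

end

open GSIO

theorem mainTheorem2 :
    semicommutatorIdeal continuousSymbols = compacts ∧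
    semicommutatorIdeal quasicontinuous = compacts ∧
    ∃ (hK : ∀ T ∈ compacts, T ∈ gsioAlgebra continuousSymbols)
      (ρ : gsioAlgebra continuousSymbols →⋆ₐ[ℂ] C(Torus, ℂ) × C(Torus, ℂ)),
      (∀ (T : gsioAlgebra continuousSymbols) (ξ : Torus),
        Tendsto (fun r : ℝ => ⟪kernelPlus (r * fourier 1 ξ),
          (T : L2 →L[ℂ] L2) (kernelPlus (r * fourier 1 ξ))⟫_ℂ) (𝓝[<] 1) (𝓝 ((ρ T).1 ξ)) ∧
        Tendsto (fun r : ℝ => ⟪kernelMinus (r * fourier 1 ξ),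
          (T : L2 →L[ℂ] L2) (kernelMinus (r * fourier 1 ξ))⟫_ℂ) (𝓝[<] 1) (𝓝 ((ρ T).2 ξ))) ∧
      (∀ (f g φ ψ : C(Torus, ℂ)) (T : gsioAlgebra continuousSymbols),
        (T : L2 →L[ℂ] L2) =
            gsio !![contToLInf f, contToLInf φ; contToLInf g, contToLInf ψ] → ρ T = (f, ψ)) ∧
      Function.Injective
        (fun K : compacts => (⟨K, hK K K.2⟩ : gsioAlgebra continuousSymbols)) ∧
      Function.Exact
        (fun K : compacts => (⟨K, hK K K.2⟩ : gsioAlgebra continuousSymbols)) ρ ∧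
      Function.Surjective ρ ∧
      ∃ e : (gsioAlgebra continuousSymbols ⧸ compactIdeal (gsioAlgebra continuousSymbols)) ≃⋆ₐ[ℂ]
          C(Torus, ℂ) × C(Torus, ℂ),
        (∀ T : gsioAlgebra continuousSymbols, e (Ideal.Quotient.mk _ T) = ρ T) ∧
        ∀ x, ‖e x‖ = ‖x‖ := by
  refine ⟨semicommutatorIdeal_eq_compacts subset_rfl continuousSymbols_subset_quasicontinuous,
    semicommutatorIdeal_eq_compacts continuousSymbols_subset_quasicontinuous subset_rfl,
    mem_gsioAlgebra_of_mem_compacts subset_rfl, symbolHom,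
    fun T ξ => ⟨(hasSymbol_symbolHom T).tendsto_kernelPlus ξ,
      (hasSymbol_symbolHom T).tendsto_kernelMinus ξ⟩,
    fun f g φ ψ T hT => symbolHom_eq (by rw [hT]; exact hasSymbol_gsio f φ g ψ),
    fun K L h => Subtype.ext
      (congrArg (fun T : gsioAlgebra continuousSymbols => (T : L2 →L[ℂ] L2)) h),
    fun T => ?_, symbolHom_surjective,
    StarAlgEquiv.ofBijective quotientSymbolHom quotientSymbolHom_bijective,
    quotientSymbolHom_mk, norm_quotientSymbolHom⟩
  rw [symbolHom_eq_zero_iff]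
  constructor
  · exact fun h => ⟨⟨T, h⟩, rfl⟩
  · rintro ⟨K, rfl⟩
    exact K.2
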